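/- Let $\mathbb F_q$ be a finite field with $q$ elements, $n\ge 2$, and let $PS(n,e,q)$ be a finite classical polar space of rank $n$ and parameter $e$ over $\mathbb F_q$. That is, its subspaces are the totally singular subspaces of a non-degenerate alternating, Hermitian or quadratic form on a finite-dimensional $\mathbb F_q$-vector space $V$, with maximal dimension $n$, of one of these kinds: symplectic, $\dim V=2n$, $e=1$; Hermitian, $\dim V=2n+1$, $e=3/2$ or $\dim V=2n$, $e=1/2$ (here $q$ is a square); quadratic, $\dim V=2n+1$, $e=1$ (parabolic), $\dim V=2n+2$, $e=2$ (elliptic), or $\dim V=2n$, $e=0$ (hyperbolic). Write $\perp$ for orthogonality (with respect to the polar form for a quadratic form). A maximal flag is a chain $0=U_0\subset U_1\subset\dots\subset U_n$ of subspaces of the polar space with $\dim U_i=i$. The vertices of the opposition graph are the maximal flags; $(U_i)$ and $(V_i)$ are adjacent if $U_i\cap V_i^\perp=0$ and $V_i\cap U_i^\perp=0$ for all $i$. Fix a point $X$ (a one-dimensional totally singular subspace). The type of a maximal flag $(U_i)$ with respect to $X$ is the smallest $k\in\{1,\dots,2n\}$ such that $X$ lies in the $k$-th member of the chain $$U_1\subseteq\dots\subseteq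 U_n\subseteq U_{n-1}^\perp\subseteq\dots\subseteq U_1^\perp\subseteq U_0^\perp=V .$$ For $i\in\{1,\dots,2n\}$ let $\mathcal C_i^X$ be the set of maximal flags of type $i$. Then $\mathcal C_1^X,\dots,\mathcal C_{2n}^X$ are exactly the distinct orbits on maximal flags of the stabilizer of $X$ in the isometry group of the form, which acts by automorphisms of the opposition graph. Let $A$ be the adjacency matrix of the opposition graph and $P$ the matrix whose columns are the indicator vectors of $\mathcal C_1^X,\dots,\mathcal C_{2n}^X$. The quotient matrix, i.e. the unique $2n\times 2n$ real matrix $Q$ with $AP=PQ$, has the entries given by $$\frac{Q_{ij}}{q^{\,n(n+e-3)-e}}=\begin{cases}0 & \text{if } i+j<2n+1,\\ (q-1+\delta_{i+j,2n+1})\,q^{j} & \text{if } i+j\ge 2n+1,\ j\le n,\\ (q-1+\delta_{i+j,2n+1})\,q^{j+e-1}+\delta_{ij}\,q^n(q^e-q) & \text{if } i+j\ge 2n+1,\ j>n.\end{cases}$$ In particular $Q$ does not depend on $X$. -/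

import Mathlib

open Module

/-! ## Finite classical polar spaces -/

/-- A non-degenerate form of one of the three classical kinds (alternating, Hermitian, quadratic)
on a vector space. -/
inductive PolarForm (K V : Type*) [Field K] [AddCommGroup V] [Module K V] where
  | symplectic (B : LinearMap.BilinForm K V) (alt : B.IsAlt) (nondeg : B.Nondegenerate)
  | hermitian (σ : K →+* K) (invol : ∀ a, σ (σ a) = a) (nontriv : σ ≠ RingHom.id K)
      (h : V →ₛₗ[σ] V →ₗ[K] K) (herm : ∀ x y, h x y = σ (h y x)) (nondeg : h.Nondegenerate)
  | quadratic (Q : QuadraticForm K V)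
      (nondeg : ∀ x, Q x = 0 → (∀ y, QuadraticMap.polar Q x y = 0) → x = 0)

namespace PolarForm

section Geometry

variable {K V : Type*} [Field K] [AddCommGroup V] [Module K V]

/-- The vector `x` is singular (isotropic). -/
def Singular (F : PolarForm K V) (x : V) : Prop :=
  match F with
  | symplectic B _ _ => B x x = 0
  | hermitian _ _ _ h _ _ => h x x = 0
  | quadratic Q _ => Q x = 0

/-- The vectors `x` and `y` are orthogonal, for the form itself or, in the quadratic case, for its
polar form. For singular vectors spanning distinct points this is collinearity. -/
def Orth (F : PolarForm K V) (x y : V) : Prop :=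
  match F with
  | symplectic B _ _ => B x y = 0
  | hermitian _ _ _ h _ _ => h x y = 0
  | quadratic Q _ => QuadraticMap.polar Q x y = 0

/-- The subspace `U^⊥`. -/
def perp (F : PolarForm K V) (U : Submodule K V) : Submodule K V where
  carrier := {y | ∀ x ∈ U, F.Orth x y}
  zero_mem' := by
    intro x _
    cases F <;> simp [Orth]
  add_mem' := by
    intro a b ha hb x hx
    have h1 := ha x hx
    have h2 := hb x hx
    cases F <;> simp only [Orth, map_add, QuadraticMap.polar_add_right] at h1 h2 ⊢ <;>
      rw [h1, h2, add_zero]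
  smul_mem' := by
    intro r a ha x hx
    have h1 := ha x hx
    cases F <;> simp only [Orth, map_smul, QuadraticMap.polar_smul_right] at h1 ⊢ <;>
      rw [h1, smul_zero]

/-- `U` is a totally singular subspace, that is, a subspace contained in the polar space. -/
def TotallySingular (F : PolarForm K V) (U : Submodule K V) : Prop :=
  ∀ x ∈ U, F.Singular x ∧ ∀ y ∈ U, F.Orth x y

/-- The rank of the polar space is `n`: the maximal dimension of a subspace contained in it. -/
def HasRank (F : PolarForm K V) (n : ℕ) : Prop :=
  IsGreatest {k | ∃ U : Submodule K V, F.TotallySingular U ∧ finrank K U = k} n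

/-- The form defines a classical polar space of rank `n` and parameter `e`. The cases are:
symplectic spaces (`e = 1`); Hermitian spaces in odd (`e = 3/2`) and in even (`e = 1/2`) dimension;
parabolic (`e = 1`), elliptic (`e = 2`) and hyperbolic (`e = 0`) quadrics. -/
def IsPS (F : PolarForm K V) (n : ℕ) (e : ℝ) : Prop :=
  F.HasRank n ∧
  match F with
  | symplectic _ _ _ => finrank K V = 2 * n ∧ e = 1
  | hermitian _ _ _ _ _ _ =>
      (finrank K V = 2 * n + 1 ∧ e = 3 / 2) ∨ (finrank K V = 2 * n ∧ e = 1 / 2)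
  | quadratic _ _ =>
      (finrank K V = 2 * n + 1 ∧ e = 1) ∨ (finrank K V = 2 * n + 2 ∧ e = 2) ∨
        (finrank K V = 2 * n ∧ e = 0)

/-- The points of the polar space. -/
def IsPoint (F : PolarForm K V) (X : Submodule K V) : Prop :=
  finrank K X = 1 ∧ F.TotallySingular X

/-- The linear map `g` preserves the form. -/
def Preserves (F : PolarForm K V) (g : V ≃ₗ[K] V) : Prop :=
  match F with
  | symplectic B _ _ => ∀ x y, B (g x) (g y) = B x y
  | hermitian _ _ _ h _ _ => ∀ x y, h (g x) (g y) = h x y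
  | quadratic Q _ => ∀ x, Q (g x) = Q x

/-- The classical group of the form: its symplectic, unitary or orthogonal group. -/
def isometryGroup (F : PolarForm K V) : Subgroup (V ≃ₗ[K] V) where
  carrier := {g | F.Preserves g}
  one_mem' := by
    cases F <;> simp [Preserves]
  mul_mem' := by
    intro a b ha hb
    cases F with
    | symplectic B _ _ => exact fun x y => (ha (b x) (b y)).trans (hb x y)
    | hermitian _ _ _ h _ _ => exact fun x y => (ha (b x) (b y)).trans (hb x y)
    | quadratic Q _ => exact fun x => (ha (b x)).trans (hb x)
  inv_mem' := by
    intro a ha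
    have key : ∀ x, a (a⁻¹ x) = x := fun x => LinearEquiv.apply_symm_apply a x
    cases F with
    | symplectic B _ _ => intro x y; rw [← ha (a⁻¹ x) (a⁻¹ y), key, key]
    | hermitian _ _ _ h _ _ => intro x y; rw [← ha (a⁻¹ x) (a⁻¹ y), key, key]
    | quadratic Q _ => intro x; rw [← ha (a⁻¹ x), key]

theorem singular_map (F : PolarForm K V) (g : F.isometryGroup) {x : V} (hx : F.Singular x) :
    F.Singular (g.1 x) := by
  obtain ⟨g, hg⟩ := g
  cases F with
  | symplectic B _ _ => exact (hg x x).trans hx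
  | hermitian _ _ _ h _ _ => exact (hg x x).trans hx
  | quadratic Q _ => exact (hg x).trans hx

theorem orth_map (F : PolarForm K V) (g : F.isometryGroup) {x y : V} (hx : F.Orth x y) :
    F.Orth (g.1 x) (g.1 y) := by
  obtain ⟨g, hg⟩ := g
  cases F with
  | symplectic B _ _ => exact (hg x y).trans hx
  | hermitian _ _ _ h _ _ => exact (hg x y).trans hx
  | quadratic Q _ =>
    have h1 : ∀ x, Q (g x) = Q x := hg
    have h2 : QuadraticMap.polar Q x y = 0 := hx
    change QuadraticMap.polar Q (g x) (g y) = 0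
    rw [← h2]
    simp only [QuadraticMap.polar, ← map_add, h1]

theorem totallySingular_map (F : PolarForm K V) (g : F.isometryGroup) {U : Submodule K V}
    (hU : F.TotallySingular U) : F.TotallySingular (U.map (g.1 : V →ₗ[K] V)) := by
  rintro _ ⟨x, hx, rfl⟩
  refine ⟨F.singular_map g (hU x hx).1, ?_⟩
  rintro _ ⟨y, hy, rfl⟩
  exact F.orth_map g ((hU x hx).2 y hy)

/-- The stabilizer of the subspace `X` in the isometry group. -/
def stabilizer (F : PolarForm K V) (X : Submodule K V) : Subgroup F.isometryGroup where
  carrier := {g | X.map (g.1 : V →ₗ[K] V) = X}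
  one_mem' := Submodule.map_id X
  mul_mem' := by
    intro a b ha hb
    have h : X.map ((a * b).1 : V →ₗ[K] V)
        = (X.map (b.1 : V →ₗ[K] V)).map (a.1 : V →ₗ[K] V) :=
      Submodule.map_comp (b.1 : V →ₗ[K] V) (a.1 : V →ₗ[K] V) X
    exact h.trans ((congrArg _ hb).trans ha)
  inv_mem' := by
    intro a ha
    have h : (X.map (a.1 : V →ₗ[K] V)).map ((a⁻¹).1 : V →ₗ[K] V) = X := by
      ext x
      simp only [Submodule.mem_map, exists_exists_and_eq_and]
      constructor
      · rintro ⟨y, hy, rfl⟩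
        simpa using hy
      · intro hx
        exact ⟨x, hx, by simp⟩
    exact (congrArg _ (ha : X.map (a.1 : V →ₗ[K] V) = X)).symm.trans h

/-! ## Maximal flags -/

/-- The maximal flags `0 = U_0 ⊂ U_1 ⊂ ⋯ ⊂ U_n` with `U_i` a subspace of dimension `i` contained
in the polar space. -/
@[ext]
structure MaxFlag (F : PolarForm K V) (n : ℕ) where
  space : Fin (n + 1) → Submodule K V
  mono : Monotone space
  rank_eq : ∀ i, finrank K (space i) = i
  singular : ∀ i, F.TotallySingular (space i)

instance (F : PolarForm K V) (n : ℕ) : MulAction F.isometryGroup (F.MaxFlag n) where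
  smul g c :=
    { space := fun i => (c.space i).map (g.1 : V →ₗ[K] V)
      mono := fun _ _ h => Submodule.map_mono (c.mono h)
      rank_eq := fun i => (LinearEquiv.finrank_map_eq g.1 (c.space i)).trans (c.rank_eq i)
      singular := fun i => F.totallySingular_map g (c.singular i) }
  one_smul c := MaxFlag.ext (funext fun i => Submodule.map_id (c.space i))
  mul_smul a b c := MaxFlag.ext (funext fun i =>
    Submodule.map_comp (b.1 : V →ₗ[K] V) (a.1 : V →ₗ[K] V) (c.space i))

instance [Finite K] [FiniteDimensional K V] (F : PolarForm K V) (n : ℕ) :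
    Finite (F.MaxFlag n) := by
  have : Finite V := Module.finite_of_finite K
  have : Finite (Submodule K V) :=
    Finite.of_injective (fun U : Submodule K V => (U : Set V)) SetLike.coe_injective
  exact Finite.of_injective (fun c : F.MaxFlag n => c.space) fun _ _ h => MaxFlag.ext h

/-- The `k`-th member of the chain `U_1 ⊆ ⋯ ⊆ U_n ⊆ U_{n-1}^⊥ ⊆ ⋯ ⊆ U_1^⊥ ⊆ U_0^⊥`, where
`U_0^⊥`, at place `2n`, is the whole space. -/
def MaxFlag.chain {F : PolarForm K V} {n : ℕ} (c : F.MaxFlag n) (k : ℕ) : Submodule K V :=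
  if h : k ≤ n then c.space ⟨k, by omega⟩ else F.perp (c.space ⟨2 * n - k, by omega⟩)

/-- The type of the maximal flag `c` with respect to the point `X`: the smallest `k ≥ 1` such that
the `k`-th member of the chain contains `X`. -/
noncomputable def MaxFlag.type {F : PolarForm K V} {n : ℕ} (c : F.MaxFlag n)
    (X : Submodule K V) : ℕ :=
  sInf {k | 1 ≤ k ∧ X ≤ c.chain k}

/-- The set of maximal flags of type `i` with respect to `X`. -/
def flagsOfType (F : PolarForm K V) (n : ℕ) (X : Submodule K V) (i : ℕ) : Set (F.MaxFlag n) :=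
  {c | c.type X = i}

/-- Two subspaces of the polar space are opposite if no point of either of them is collinear or
equal to all points of the other one. -/
def Opposite (F : PolarForm K V) (U W : Submodule K V) : Prop :=
  U ⊓ F.perp W = ⊥ ∧ W ⊓ F.perp U = ⊥

/-- The opposition graph on maximal flags: two flags are adjacent if their members of equal
dimension are opposite. -/
def oppositionGraph (F : PolarForm K V) (n : ℕ) : SimpleGraph (F.MaxFlag n) where
  Adj c d := c ≠ d ∧ ∀ i, F.Opposite (c.space i) (d.space i)
  symm := ⟨fun _ _ h => ⟨h.1.symm, fun i => (h.2 i).symm⟩⟩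
  loopless := ⟨fun _ h => h.1 rfl⟩

end Geometry

end PolarForm

/-! ## Quotient matrices -/

open Classical in
/-- The characteristic matrix of a family of sets: its columns are their indicator vectors. -/
noncomputable def characteristicMatrix {Ω ι : Type*} (O : ι → Set Ω) : Matrix Ω ι ℝ :=
  Matrix.of fun c i => if c ∈ O i then 1 else 0

open Classical in
/-- `Q` is the quotient matrix of the graph `Γ` under the group `H` of automorphisms of `Γ`, where
the (distinct) orbits of `H` on the vertices are listed as `O i`, `i : ι`. -/
structure IsQuotientMatrix {Ω G ι : Type*} [Finite Ω] [Fintype ι] [Group G] [MulAction G Ω]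
    (Γ : SimpleGraph Ω) (H : Subgroup G) (O : ι → Set Ω) (Q : Matrix ι ι ℝ) : Prop where
  aut : ∀ g ∈ H, ∀ c d : Ω, Γ.Adj (g • c) (g • d) ↔ Γ.Adj c d
  injective : Function.Injective O
  orbits : Set.range O = Set.range fun c : Ω => MulAction.orbit H c
  eq : letI := Fintype.ofFinite Ω
    Γ.adjMatrix ℝ * characteristicMatrix O = characteristicMatrix O * Q

/-! Entry (i, j) has to be the number of flags d of type j opposite to a flag c of type i. The
stabilizer of c is transitive on the points of type i for c (`MaxFlag.exists_smul_eq_self_map_eq`),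
so this number is the same for every such point and can be found by averaging. Count pairs (v, d),
with d opposite to c and v a singular vector of type i for c and of type j for d
(`MaxFlag.card_adj_type_mul`): entry (i, j) * |level i of c| = degree * |level i of c ∩ level j of
d|.

The last factor is a second difference of the numbers of singular vectors in c_i ∩ d_k, which are
the same for all opposite c, d. If i ≤ n or k ≤ n, the intersection is totally singular and
opposition fixes its dimension. Otherwise it is an intersection of two orthogonal complements
(`singCard_perp_inf_perp`): those of its singular vectors that are orthogonal to c_n lie in c_n by
maximality, and the remaining vectors fall into cosets of a totally singular subspace, each with the
same proportion of singular vectors. That proportion is |ker tr| / q, where tr is the map by which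
`norm` fails to be additive. The same principle gives the degree, one dimension at a time
(`card_opposite_extensions`).

The kind of form thus enters only through |V| * |ker tr| = q ^ (2n + e), that is, through w = q ^ (e
- 1). What remains is arithmetic in q and w (`typeCount_mul`). Transitivity comes from explicit
isometries, reflections and Siegel transformations, which replace Witt's theorem. -/

namespace PolarForm

/-! ### The three kinds of form as one; reflections and Siegel transformations. -/

section Uniform

variable {K V : Type*} [Field K] [AddCommGroup V] [Module K V]

/-- The field automorphism of the form: trivial unless the form is Hermitian. -/
def conj : PolarForm K V → (K →+* K)
  | symplectic _ _ _ => RingHom.id K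
  | hermitian σ _ _ _ _ _ => σ
  | quadratic _ _ => RingHom.id K

/-- The sesquilinear form, which is the polar form for a quadratic form. -/
def form : (F : PolarForm K V) → V →ₛₗ[F.conj] V →ₗ[K] K
  | symplectic B _ _ => B
  | hermitian _ _ _ h _ _ => h
  | quadratic Q _ => Q.polarBilin

/-- The sign `ε` in `form x y = ε * conj (form y x)`. -/
def sgn : PolarForm K V → K
  | symplectic _ _ _ => -1
  | hermitian _ _ _ _ _ _ => 1
  | quadratic _ _ => 1

/-- The function whose zeros are the singular vectors. -/
def norm : PolarForm K V → V → K
  | symplectic _ _ _ => fun _ => 0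
  | hermitian _ _ _ h _ _ => fun x => h x x
  | quadratic Q _ => fun x => Q x

/-- The additive map with `norm (x + y) = norm x + norm y + tr (form x y)`. -/
def tr : PolarForm K V → (K →+ K)
  | symplectic _ _ _ => 0
  | hermitian σ _ _ _ _ _ => AddMonoidHom.id K + σ.toAddMonoidHom
  | quadratic _ _ => AddMonoidHom.id K

variable (F : PolarForm K V)

theorem conj_conj (a : K) : F.conj (F.conj a) = a := by
  cases F with
  | symplectic B _ _ => rfl
  | hermitian σ i _ h _ _ => exact i a
  | quadratic Q _ => rfl

instance : RingHomSurjective F.conj := ⟨fun a => ⟨F.conj a, F.conj_conj a⟩⟩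

theorem form_swap (x y : V) : F.form x y = F.sgn * F.conj (F.form y x) := by
  cases F with
  | symplectic B h _ => exact (h.neg_eq y x).symm.trans (neg_one_mul (B y x)).symm
  | hermitian σ i _ h hh _ => exact (hh x y).trans (one_mul _).symm
  | quadratic Q _ => exact (QuadraticMap.polar_comm Q x y).trans (one_mul _).symm

theorem sgn_mul_sgn : F.sgn * F.sgn = 1 := by
  cases F <;> simp [sgn]

theorem conj_sgn : F.conj F.sgn = F.sgn := by
  cases F <;> simp [sgn]

theorem sgn_ne_zero : F.sgn ≠ 0 := by
  cases F <;> simp [sgn]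

theorem form_eq_zero_comm {x y : V} : F.form x y = 0 ↔ F.form y x = 0 := by
  rw [form_swap F x y]
  simp [F.sgn_ne_zero]

theorem norm_add (x y : V) : F.norm (x + y) = F.norm x + F.norm y + F.tr (F.form x y) := by
  cases F with
  | symplectic B h _ => simp [norm, tr]
  | hermitian σ i _ h hh _ =>
    change h (x + y) (x + y) = h x x + h y y + (h x y + σ (h x y))
    rw [← hh y x, map_add, map_add, LinearMap.add_apply, LinearMap.add_apply]
    ring
  | quadratic Q _ =>
    change Q (x + y) = Q x + Q y + (Q (x + y) - Q x - Q y)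
    ring

theorem norm_smul (a : K) (x : V) : F.norm (a • x) = F.conj a * a * F.norm x := by
  cases F with
  | symplectic B h _ => simp [norm]
  | hermitian σ i _ h hh _ =>
    change h (a • x) (a • x) = σ a * a * h x x
    rw [h.map_smulₛₗ a x, LinearMap.smul_apply, LinearMap.map_smul, smul_eq_mul, smul_eq_mul]
    ring
  | quadratic Q _ => simp [norm, conj, QuadraticMap.map_smul]

theorem tr_conj (a : K) : F.tr (F.conj a) = F.tr a := by
  cases F with
  | symplectic B h _ => rfl
  | hermitian σ i _ h hh _ =>
    change σ a + σ (σ a) = a + σ a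
    rw [i, add_comm]
  | quadratic Q _ => rfl

theorem tr_sgn_mul (a : K) : F.tr (F.sgn * a) = F.tr a := by
  cases F <;> simp [tr, sgn]

theorem tr_conj_mul_self_mul (a c : K) : F.tr (F.conj a * a * c) = F.conj a * a * F.tr c := by
  cases F with
  | symplectic B h _ => simp [tr]
  | hermitian σ i _ h hh _ =>
    change σ a * a * c + σ (σ a * a * c) = σ a * a * (c + σ c)
    rw [map_mul, map_mul, i]
    ring
  | quadratic Q _ => rfl

theorem tr_form_comm (x y : V) : F.tr (F.form x y) = F.tr (F.form y x) := by
  rw [form_swap, tr_sgn_mul, tr_conj]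

theorem form_self {x : V} (hx : F.norm x = 0) : F.form x x = 0 := by
  cases F with
  | symplectic B h _ => exact h x
  | hermitian σ i _ h hh _ => exact hx
  | quadratic Q _ =>
    have : Q x = 0 := hx
    change QuadraticMap.polar Q x x = 0
    simp [this]

/-- The non-degeneracy common to all kinds. The restriction to singular x is needed: the polar form
of a parabolic quadric in characteristic 2 has a nonzero radical. -/
theorem eq_zero_of_form_eq_zero {x : V} (hx : F.norm x = 0) (h : ∀ y, F.form x y = 0) :
    x = 0 := by
  cases F with
  | symplectic B _ hB => exact hB.1 x h
  | hermitian σ i _ B hh hB => exact hB.1 x h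
  | quadratic Q hQ => exact hQ x hx h

theorem singular_iff {x : V} : F.Singular x ↔ F.norm x = 0 := by
  cases F with
  | symplectic B h _ => exact iff_of_true (h x) rfl
  | hermitian σ i _ h hh _ => rfl
  | quadratic Q _ => rfl

theorem orth_iff {x y : V} : F.Orth x y ↔ F.form x y = 0 := by
  cases F <;> rfl

theorem mem_perp {U : Submodule K V} {y : V} : y ∈ F.perp U ↔ ∀ x ∈ U, F.form x y = 0 := by
  simp only [← orth_iff]
  rfl

theorem totallySingular_iff {U : Submodule K V} :
    F.TotallySingular U ↔ ∀ x ∈ U, F.norm x = 0 ∧ ∀ y ∈ U, F.form x y = 0 := by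
  simp only [TotallySingular, orth_iff, singular_iff]

theorem preserves_of_form_of_norm {g : V ≃ₗ[K] V} (hg : ∀ x y, F.form (g x) (g y) = F.form x y)
    (hN : ∀ x, F.norm (g x) = F.norm x) : F.Preserves g := by
  cases F with
  | symplectic B h _ => exact hg
  | hermitian σ i _ h hh _ => exact hg
  | quadratic Q _ => exact hN

/-- In the Hermitian case the norm of x is fixed by σ, and rescaling an element of nonzero trace
gives it as a trace. This is what allows a vector to be made singular by adding a suitable singular
vector. -/
theorem exists_tr_eq_norm [Finite K] (x : V) : ∃ a, F.tr a = F.norm x := by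
  cases F with
  | symplectic B h _ => exact ⟨0, rfl⟩
  | hermitian σ i hσ h hh _ =>
    -- If all traces vanished, the trace of 1 would give 2 = 0, and then σ a = -a = a for all a.
    obtain ⟨c, hc⟩ : ∃ c, c + σ c ≠ 0 := by
      by_contra! H
      refine hσ (RingHom.ext fun a => ?_)
      have h1 := H 1
      have h2 := H a
      rw [map_one] at h1
      simp only [RingHom.id_apply]
      linear_combination h2 - a * h1
    refine ⟨h x x * c * (c + σ c)⁻¹, ?_⟩
    change h x x * c * (c + σ c)⁻¹ + σ (h x x * c * (c + σ c)⁻¹) = h x x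
    have h3 : σ (c + σ c) = c + σ c := by rw [map_add, i, add_comm]
    rw [map_mul, map_mul, map_inv₀, h3, ← hh]
    field_simp
  | quadratic Q _ => exact ⟨Q x, rfl⟩

/-- A linear map that preserves the form is an isometry. -/
theorem exists_isometry_of_linearMap [FiniteDimensional K V] (g : V →ₗ[K] V)
    (hg : ∀ x y, F.form (g x) (g y) = F.form x y) (hN : ∀ x, F.norm (g x) = F.norm x) :
    ∃ g' : F.isometryGroup, ∀ v, g'.1 v = g v := by
  have hinj : Function.Injective g := by
    rw [injective_iff_map_eq_zero]
    intro v hv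
    refine F.eq_zero_of_form_eq_zero ?_ fun y => ?_
    · rw [← hN, hv]
      simpa using F.norm_smul 0 0
    · rw [← hg, hv]
      simp
  exact ⟨⟨LinearEquiv.ofInjectiveEndo g hinj, F.preserves_of_form_of_norm hg hN⟩, fun _ => rfl⟩

theorem norm_neg (x : V) : F.norm (-x) = F.norm x := by
  have := F.norm_smul (-1) x
  simpa using this

theorem norm_sub (x y : V) : F.norm (x - y) = F.norm x + F.norm y - F.tr (F.form x y) := by
  rw [sub_eq_add_neg, norm_add, norm_neg]
  simp [sub_eq_add_neg]

theorem form_smul_left (a : K) (x y : V) : F.form (a • x) y = F.conj a * F.form x y := by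
  rw [LinearMap.map_smulₛₗ]; rfl

/-- The reflection that interchanges two singular vectors that are not orthogonal. -/
theorem exists_isometry_reflection [FiniteDimensional K V] {x y : V} (hx : F.norm x = 0)
    (hy : F.norm y = 0) (hxy : F.form y x ≠ 0) :
    ∃ g : F.isometryGroup, g.1 x = y ∧ ∀ v, F.form x v = F.form y v → g.1 v = v := by
  obtain ⟨g, hg⟩ := F.exists_isometry_of_linearMap
    -- A multiple of x - y is added to v. The scalar is chosen so that x goes to y; the form is then
    -- preserved because x and y are singular, so that form (x - y) (x - y) = -form x y - form y x.
    (LinearMap.id + (((F.form y x)⁻¹ • F.form (x - y)).smulRight (x - y))) (by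
      intro v v'
      simp only [LinearMap.add_apply, LinearMap.id_apply, LinearMap.smulRight_apply,
        LinearMap.smul_apply, smul_eq_mul]
      simp only [map_add, LinearMap.add_apply, F.form_smul_left, map_smul, smul_eq_mul]
      have h1 : F.form (x - y) (x - y) = - F.form x y - F.form y x := by
        simp [F.form_self hx, F.form_self hy]
      have h2 : F.form v (x - y) = F.sgn * F.conj (F.form (x - y) v) := F.form_swap _ _
      have h3 : F.form x y = F.sgn * F.conj (F.form y x) := F.form_swap _ _
      have h4 := F.sgn_mul_sgn
      have h5 : F.conj (F.form y x) ≠ 0 := by simpa using hxy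
      rw [h1, h2, h3, map_mul, map_inv₀]
      field_simp
      ring) (by
      intro v
      simp only [LinearMap.add_apply, LinearMap.id_apply, LinearMap.smulRight_apply,
        LinearMap.smul_apply, smul_eq_mul]
      rw [norm_add, norm_smul, norm_sub, hx, hy, F.tr_form_comm x y]
      have h2 : F.form v (x - y) = F.sgn * F.conj (F.form (x - y) v) := F.form_swap _ _
      simp only [map_smul, smul_eq_mul, h2]
      clear h2
      generalize F.form (x - y) v = r at *
      obtain ⟨l, rfl⟩ : ∃ l, r = l * F.form y x := ⟨r * (F.form y x)⁻¹, by field_simp⟩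
      have h3 : (F.form y x)⁻¹ * (l * F.form y x) = l := by field_simp
      rw [h3, map_mul F.conj]
      have h4 : F.tr (l * (F.sgn * (F.conj l * F.conj (F.form y x))))
          = F.conj l * l * F.tr (F.form y x) := by
        rw [show l * (F.sgn * (F.conj l * F.conj (F.form y x)))
          = F.sgn * (F.conj l * l * F.conj (F.form y x)) by ring, tr_sgn_mul,
          tr_conj_mul_self_mul, tr_conj]
      rw [h4]
      ring)
  refine ⟨g, ?_, fun v hv => ?_⟩
  · rw [hg]
    simp [F.form_self hx, hxy]
  · rw [hg]
    simp [hv]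

/-- The Siegel transformation with axis `y` that moves `x` to `x'`. -/
theorem exists_isometry_siegel [FiniteDimensional K V] {x x' y : V} (hx : F.norm x = 0)
    (hx' : F.norm x' = 0) (hy : F.norm y = 0) (hyx : F.form y x = 1) (hyx' : F.form y x' = 1) :
    ∃ g : F.isometryGroup, g.1 x = x' ∧ ∀ v, g.1 v = v + F.form y v • (x' - x)
      + (F.sgn * (F.form x' x * F.form y v - F.form (x' - x) v)) • y := by
  have hyz : F.form y (x' - x) = 0 := by rw [map_sub, hyx, hyx', sub_self]
  have hzy : F.form (x' - x) y = 0 := F.form_eq_zero_comm.1 hyz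
  have hyy := F.form_self hy
  have hxx := F.form_self hx
  have hxx' := F.form_self hx'
  obtain ⟨g, hg⟩ := F.exists_isometry_of_linearMap
    -- Adding form y v • (x' - x) carries x to x' but disturbs the form. Since y is singular and
    -- orthogonal to x' - x, a multiple of y repairs this, and it vanishes at v = x.
    (LinearMap.id + (F.form y).smulRight (x' - x)
      + (F.sgn • (F.form x' x • F.form y - F.form (x' - x))).smulRight y) (by
      intro v v'
      simp only [LinearMap.add_apply, LinearMap.id_apply, LinearMap.smulRight_apply,
        LinearMap.sub_apply, LinearMap.smul_apply, smul_eq_mul]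
      have h1 : F.form v y = F.sgn * F.conj (F.form y v) := F.form_swap _ _
      have h2 : F.form v (x' - x) = F.sgn * F.conj (F.form (x' - x) v) := F.form_swap _ _
      have h3 : F.form (x' - x) (x' - x) = - F.form x' x - F.form x x' := by
        simp [hxx, hxx']
      have h4 : F.form x x' = F.sgn * F.conj (F.form x' x) := F.form_swap _ _
      have h5 := F.sgn_mul_sgn
      generalize x' - x = z at *
      simp only [map_add, LinearMap.add_apply, F.form_smul_left, map_smul, smul_eq_mul,
        hyz, hzy, hyy, h1, h2, h3, h4, map_sub, map_mul, F.conj_sgn]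
      generalize F.form y v' = b'
      generalize F.form y v = b
      generalize F.conj b = cb
      generalize F.form z v' = r'
      generalize F.conj (F.form z v) = r
      generalize F.form x' x = c
      generalize F.conj c = cc
      generalize F.sgn = ε at *
      linear_combination (b' * cb * c - cb * r') * h5) (by
      intro v
      simp only [LinearMap.add_apply, LinearMap.id_apply, LinearMap.smulRight_apply,
        LinearMap.sub_apply, LinearMap.smul_apply, smul_eq_mul]
      have h1 : F.form v y = F.sgn * F.conj (F.form y v) := F.form_swap _ _
      have h2 : F.form v (x' - x) = F.sgn * F.conj (F.form (x' - x) v) := F.form_swap _ _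
      have h3 : F.norm (x' - x) = - F.tr (F.form x' x) := by
        rw [norm_sub, hx, hx']; ring
      generalize x' - x = z at *
      rw [norm_add, norm_add, norm_smul, norm_smul, hy, h3]
      simp only [map_add, LinearMap.add_apply, F.form_smul_left, map_smul, smul_eq_mul,
        hzy, h1, h2]
      have e1 : F.tr (F.form y v * (F.sgn * F.conj (F.form z v)))
          = F.tr (F.form z v * F.conj (F.form y v)) := by
        rw [← F.tr_conj (F.form z v * _), map_mul F.conj, conj_conj,
          ← F.tr_sgn_mul (_ * F.form y v)]
        congr 1; ring
      have e2 : F.tr (F.sgn * (F.form x' x * F.form y v - F.form z v)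
          * (F.sgn * F.conj (F.form y v))) = F.conj (F.form y v) * F.form y v * F.tr (F.form x' x)
            - F.tr (F.form z v * F.conj (F.form y v)) := by
        rw [← tr_conj_mul_self_mul, ← map_sub]
        congr 1
        linear_combination (F.form x' x * F.form y v - F.form z v) * F.conj (F.form y v)
          * F.sgn_mul_sgn
      simp only [mul_zero, add_zero, e1, e2]
      ring)
  refine ⟨g, ?_, fun v => ?_⟩
  · rw [hg]
    simp [hyx, hxx]
  · rw [hg]
    simp

end Uniform

end PolarForm

/-! ### Orthogonal complements and their cardinalities. -/

/-- The cardinality of a finite additive group is that of a fibre times that of the image. -/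
theorem AddMonoidHom.card_ker_mul_card_of_surjective {G H : Type*} [AddGroup G] [AddGroup H]
    (f : G →+ H) (hf : Function.Surjective f) :
    Nat.card f.ker * Nat.card H = Nat.card G := by
  rw [← AddSubgroup.card_mul_index f.ker, AddSubgroup.index_ker,
    AddMonoidHom.range_eq_top_of_surjective f hf]
  simp

theorem AddMonoidHom.card_fiber {G H : Type*} [AddGroup G] [AddGroup H]
    (f : G →+ H) (g : G) : Nat.card {x // f x = f g} = Nat.card f.ker := by
  refine Nat.card_congr
    { toFun := fun x => ⟨x.1 - g, by simp [AddMonoidHom.mem_ker, x.2]⟩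
      invFun := fun x => ⟨x.1 + g, by simp [AddMonoidHom.mem_ker.1 x.2]⟩
      left_inv := fun x => by simp
      right_inv := fun x => by simp }

theorem Module.natCard_eq_pow_finrank_of_field (K V : Type*) [Field K] [Finite K] [AddCommGroup V]
    [Module K V] [FiniteDimensional K V] : Nat.card V = Nat.card K ^ finrank K V := by
  have := Fintype.ofFinite K
  have : Finite V := Module.finite_of_finite K
  have := Fintype.ofFinite V
  simpa using Module.card_eq_pow_finrank (K := K) (V := V)

namespace PolarForm

section Perp

variable {K V : Type*} [Field K] [AddCommGroup V] [Module K V] (F : PolarForm K V)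

theorem perp_anti {U W : Submodule K V} (h : U ≤ W) : F.perp W ≤ F.perp U := by
  intro y hy
  rw [mem_perp] at hy ⊢
  exact fun x hx => hy x (h hx)

theorem le_perp_comm {U W : Submodule K V} : U ≤ F.perp W ↔ W ≤ F.perp U := by
  simp only [SetLike.le_def, mem_perp]
  exact ⟨fun h x hx y hy => F.form_eq_zero_comm.1 (h hy x hx),
    fun h x hx y hy => F.form_eq_zero_comm.1 (h hy x hx)⟩

theorem mem_perp' {U : Submodule K V} {y : V} : y ∈ F.perp U ↔ ∀ x ∈ U, F.form y x = 0 := by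
  rw [mem_perp]
  exact forall₂_congr fun x _ => F.form_eq_zero_comm

theorem perp_sup (U W : Submodule K V) : F.perp (U ⊔ W) = F.perp U ⊓ F.perp W := by
  refine le_antisymm (le_inf (F.perp_anti le_sup_left) (F.perp_anti le_sup_right)) ?_
  rw [le_perp_comm]
  exact sup_le (F.le_perp_comm.1 inf_le_left) (F.le_perp_comm.1 inf_le_right)

theorem mem_perp_span {x y : V} : y ∈ F.perp (K ∙ x) ↔ F.form x y = 0 := by
  rw [mem_perp]
  refine ⟨fun h => h x (Submodule.mem_span_singleton_self x), fun h z hz => ?_⟩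
  obtain ⟨a, rfl⟩ := Submodule.mem_span_singleton.1 hz
  rw [form_smul_left, h, mul_zero]

theorem perp_bot : F.perp ⊥ = ⊤ := by
  rw [eq_top_iff]
  intro y _
  rw [mem_perp]
  intro x hx
  rw [(Submodule.mem_bot K).1 hx]
  simp

variable {F}

theorem TotallySingular.norm_eq_zero {U : Submodule K V} (hU : F.TotallySingular U) {x : V}
    (hx : x ∈ U) : F.norm x = 0 :=
  (F.totallySingular_iff.1 hU x hx).1

theorem TotallySingular.le_perp {U : Submodule K V} (hU : F.TotallySingular U) :
    U ≤ F.perp U := by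
  intro y hy
  rw [mem_perp]
  exact fun x hx => (F.totallySingular_iff.1 hU x hx).2 y hy

theorem TotallySingular.mono {U W : Submodule K V} (hW : F.TotallySingular W) (h : U ≤ W) :
    F.TotallySingular U :=
  fun x hx => ⟨(hW x (h hx)).1, fun y hy => (hW x (h hx)).2 y (h hy)⟩

theorem TotallySingular.sup {U W : Submodule K V} (hU : F.TotallySingular U)
    (hW : F.TotallySingular W) (h : W ≤ F.perp U) : F.TotallySingular (U ⊔ W) := by
  have hp : U ⊔ W ≤ F.perp (U ⊔ W) := by
    rw [perp_sup]
    exact sup_le (le_inf hU.le_perp (F.le_perp_comm.1 h)) (le_inf h hW.le_perp)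
  rw [totallySingular_iff]
  refine fun x hx => ⟨?_, fun y hy => (F.mem_perp.1 (hp hy)) x hx⟩
  obtain ⟨u, hu, w, hw, rfl⟩ := Submodule.mem_sup.1 hx
  rw [norm_add, hU.norm_eq_zero hu, hW.norm_eq_zero hw, (F.mem_perp.1 (h hw)) u hu]
  simp

theorem totallySingular_span {x : V} (hx : F.norm x = 0) : F.TotallySingular (K ∙ x) := by
  rw [totallySingular_iff]
  intro y hy
  obtain ⟨a, rfl⟩ := Submodule.mem_span_singleton.1 hy
  refine ⟨by rw [norm_smul, hx, mul_zero], fun z hz => ?_⟩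
  obtain ⟨b, rfl⟩ := Submodule.mem_span_singleton.1 hz
  rw [map_smul, form_smul_left, F.form_self hx]
  simp

/-- Every linear functional on `A` is represented by a vector of `B` if no vector of `A` is
orthogonal to `B`. -/
theorem exists_form_eq [FiniteDimensional K V] {A B : Submodule K V}
    (h : ∀ y ∈ A, y ∈ F.perp B → y = 0) (φ : Dual K A) :
    ∃ x ∈ B, ∀ y : A, F.form x y = φ y := by
  let L : B →ₛₗ[F.conj] Dual K A := (A.dualRestrict ∘ₛₗ F.form) ∘ₛₗ B.subtype
  -- A proper subspace of the dual of A would annihilate a nonzero vector of A, and that vector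
  -- would be orthogonal to B.
  have hL : L.range = ⊤ := by
    rw [← Subspace.dualCoannihilator_dualAnnihilator_eq (W := L.range)]
    have : L.range.dualCoannihilator = ⊥ := by
      rw [eq_bot_iff]
      intro y hy
      rw [Submodule.mem_dualCoannihilator] at hy
      refine (Submodule.mem_bot K).2 (Subtype.ext (h y y.2 (F.mem_perp.2 fun x hx => ?_)))
      exact hy (L ⟨x, hx⟩) (LinearMap.mem_range_self L ⟨x, hx⟩)
    rw [this, Submodule.dualAnnihilator_bot]
  obtain ⟨x, hx⟩ := LinearMap.range_eq_top.1 hL φ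
  exact ⟨x, x.2, fun y => LinearMap.congr_fun hx y⟩

/-- The cardinality of an orthogonal complement. -/
theorem card_inf_perp_mul_card [Finite K] [FiniteDimensional K V] {A B : Submodule K V}
    (h : ∀ x ∈ B, x ∈ F.perp A → x = 0) :
    Nat.card (A ⊓ F.perp B : Submodule K V) * Nat.card B = Nat.card A := by
  -- The intersection is the kernel of the map that sends a vector of A to its functional on B.
  let L : A →ₛₗ[F.conj] Dual K B := (B.dualRestrict ∘ₛₗ F.form) ∘ₛₗ A.subtype
  have hL : Function.Surjective L.toAddMonoidHom := by
    intro φ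
    obtain ⟨x, hx, hφ⟩ := exists_form_eq h φ
    exact ⟨⟨x, hx⟩, LinearMap.ext hφ⟩
  rw [← AddMonoidHom.card_ker_mul_card_of_surjective _ hL,
    Module.natCard_eq_pow_finrank_of_field K B, ← Subspace.dual_finrank_eq,
    ← Module.natCard_eq_pow_finrank_of_field K]
  congr 1
  refine Nat.card_congr
    { toFun := fun x => ⟨⟨x.1, x.2.1⟩, ?_⟩
      invFun := fun x => ⟨x.1, x.1.2, ?_⟩
      left_inv := fun x => rfl
      right_inv := fun x => rfl }
  · rw [AddMonoidHom.mem_ker]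
    exact LinearMap.ext fun y => F.mem_perp'.1 x.2.2 y y.2
  · refine F.mem_perp'.2 fun y hy => ?_
    exact LinearMap.congr_fun (AddMonoidHom.mem_ker.1 x.2) ⟨y, hy⟩

theorem TotallySingular.eq_zero_of_mem_perp_top {S : Submodule K V} (hS : F.TotallySingular S)
    {x : V} (hx : x ∈ S) (h : x ∈ F.perp ⊤) : x = 0 :=
  F.eq_zero_of_form_eq_zero (hS.norm_eq_zero hx) fun y => F.mem_perp'.1 h y trivial

theorem card_perp_mul_card [Finite K] [FiniteDimensional K V] {S : Submodule K V}
    (hS : F.TotallySingular S) : Nat.card (F.perp S) * Nat.card S = Nat.card V := by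
  have := card_inf_perp_mul_card (F := F) (A := ⊤) (B := S)
    fun x hx => hS.eq_zero_of_mem_perp_top hx
  rwa [top_inf_eq, Nat.card_congr (Submodule.topEquiv (R := K) (M := V)).toEquiv] at this

/-- A nonzero linear functional on a totally singular subspace is represented by a singular
vector. -/
theorem exists_singular_form_eq [Finite K] [FiniteDimensional K V] {S : Submodule K V}
    (hS : F.TotallySingular S) (φ : Dual K V) {s : V} (hs : s ∈ S) (hφ : φ s ≠ 0) :
    ∃ z, F.norm z = 0 ∧ ∀ y ∈ S, F.form z y = φ y := by
  obtain ⟨z, -, hz⟩ := exists_form_eq (F := F) (A := S) (B := ⊤)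
    (fun x hx => hS.eq_zero_of_mem_perp_top hx) (S.dualRestrict φ)
  obtain ⟨a, ha⟩ := F.exists_tr_eq_norm z
  have hz' : ∀ y ∈ S, F.form z y = φ y := fun y hy => hz ⟨y, hy⟩
  -- Subtracting a multiple of s changes no value on the totally singular S, and changes the norm of
  -- z by minus the trace of a.
  refine ⟨z - (a * (φ s)⁻¹) • s, ?_, fun y hy => ?_⟩
  · rw [norm_sub, norm_smul, hS.norm_eq_zero hs, map_smul, hz' s hs, smul_eq_mul,
      inv_mul_cancel_right₀ hφ, ha]
    ring
  · rw [map_sub, LinearMap.sub_apply, form_smul_left, F.mem_perp.1 (hS.le_perp hy) s hs, hz' y hy]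
    simp

end Perp

end PolarForm

/-! ### Transitivity on maximal flags. -/

theorem Submodule.exists_dual_ne_zero_of_notMem {K V : Type*} [Field K] [AddCommGroup V]
    [Module K V] {U : Submodule K V} {x y : V} (hx : x ∉ U) (hy : y ∉ U) :
    ∃ φ : Dual K V, (∀ u ∈ U, φ u = 0) ∧ φ x ≠ 0 ∧ φ y ≠ 0 := by
  obtain ⟨f, hfx, hf⟩ := U.exists_le_ker_of_notMem hx
  obtain ⟨g, hgy, hg⟩ := U.exists_le_ker_of_notMem hy
  by_cases h1 : f y = 0
  · by_cases h2 : g x = 0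
    · exact ⟨f + g, fun u hu => by simp [LinearMap.mem_ker.1 (hf hu), LinearMap.mem_ker.1 (hg hu)],
        by simpa [h2], by simpa [h1]⟩
    · exact ⟨g, fun u hu => hg hu, h2, hgy⟩
  · exact ⟨f, fun u hu => hf hu, hfx, h1⟩

/-- A subspace is spanned by a hyperplane and a vector outside of it. -/
theorem Submodule.sup_span_eq_of_finrank_eq {K V : Type*} [Field K] [AddCommGroup V]
    [Module K V] [FiniteDimensional K V] {U W : Submodule K V} (h : U ≤ W)
    (hr : finrank K W = finrank K U + 1) {x : V} (hx : x ∈ W) (hxU : x ∉ U) :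
    U ⊔ (K ∙ x) = W := by
  have hle : U ⊔ (K ∙ x) ≤ W := sup_le h ((Submodule.span_singleton_le_iff_mem x W).2 hx)
  refine Submodule.eq_of_le_of_finrank_le hle ?_
  rw [hr]
  refine Submodule.finrank_lt_finrank_of_lt (lt_of_le_of_ne le_sup_left fun h' => hxU ?_)
  rw [h']
  exact Submodule.mem_sup_right (Submodule.mem_span_singleton_self x)

theorem Submodule.finrank_sup_span {K V : Type*} [Field K] [AddCommGroup V]
    [Module K V] [FiniteDimensional K V] {U : Submodule K V} {x : V} (hxU : x ∉ U) :
    finrank K (U ⊔ (K ∙ x) : Submodule K V) = finrank K U + 1 := by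
  have hx : x ≠ 0 := fun h => hxU (h ▸ U.zero_mem)
  have h1 := Submodule.finrank_sup_add_finrank_inf_eq U (K ∙ x)
  rw [finrank_span_singleton hx, (Submodule.disjoint_span_singleton' hx).2 hxU |>.eq_bot,
    finrank_bot] at h1
  exact h1

namespace PolarForm

section Transitivity

variable {K V : Type*} [Field K] [AddCommGroup V] [Module K V] {F : PolarForm K V}

/-- If x and y are not orthogonal, the reflection between them fixes U. If they are, a singular z is
inserted that is orthogonal to U but to neither x nor y, and two reflections x → z → y are composed.
Such a z represents a functional that vanishes on U and at neither point. -/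
theorem exists_isometry_fix [Finite K] [FiniteDimensional K V] {U : Submodule K V}
    (hU : F.TotallySingular U) {x y : V} (hx : F.norm x = 0) (hy : F.norm y = 0)
    (hxU : x ∈ F.perp U) (hyU : y ∈ F.perp U) (hx' : x ∉ U) (hy' : y ∉ U) :
    ∃ g : F.isometryGroup, g.1 x = y ∧ ∀ u ∈ U, g.1 u = u := by
  rw [mem_perp'] at hxU hyU
  by_cases h : F.form y x = 0
  · obtain ⟨φ, hφ, hφx, hφy⟩ := Submodule.exists_dual_ne_zero_of_notMem hx' hy'
    have hS : F.TotallySingular (U ⊔ ((K ∙ x) ⊔ (K ∙ y))) := by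
      refine hU.sup ((totallySingular_span hx).sup (totallySingular_span hy) ?_) ?_
      · rw [Submodule.span_singleton_le_iff_mem, mem_perp_span]
        exact F.form_eq_zero_comm.1 h
      · refine sup_le ?_ ?_ <;> rw [Submodule.span_singleton_le_iff_mem, mem_perp'] <;> assumption
    have hxS : x ∈ U ⊔ ((K ∙ x) ⊔ (K ∙ y)) :=
      Submodule.mem_sup_right (Submodule.mem_sup_left (Submodule.mem_span_singleton_self x))
    have hyS : y ∈ U ⊔ ((K ∙ x) ⊔ (K ∙ y)) :=
      Submodule.mem_sup_right (Submodule.mem_sup_right (Submodule.mem_span_singleton_self y))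
    obtain ⟨z, hz, hzφ⟩ := exists_singular_form_eq hS φ hxS hφx
    have hzU : ∀ u ∈ U, F.form z u = 0 := fun u hu =>
      (hzφ u (Submodule.mem_sup_left hu)).trans (hφ u hu)
    obtain ⟨g₁, h₁, h₁'⟩ := F.exists_isometry_reflection hx hz (by rwa [hzφ x hxS])
    obtain ⟨g₂, h₂, h₂'⟩ := F.exists_isometry_reflection hz hy
      (fun h0 => hφy (by rw [← hzφ y hyS, F.form_eq_zero_comm.1 h0]))
    refine ⟨g₂ * g₁, (congrArg g₂.1 h₁).trans h₂, fun u hu => ?_⟩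
    exact (congrArg g₂.1 (h₁' u (by rw [hxU u hu, hzU u hu]))).trans
      (h₂' u (by rw [hyU u hu, hzU u hu]))
  · obtain ⟨g, h1, h2⟩ := F.exists_isometry_reflection hx hy h
    exact ⟨g, h1, fun u hu => h2 u (by rw [hxU u hu, hyU u hu])⟩

theorem map_eq_self_of_fix {g : V ≃ₗ[K] V} {U : Submodule K V} (h : ∀ u ∈ U, g u = u) :
    U.map (g : V →ₗ[K] V) = U := by
  ext v
  simp only [Submodule.mem_map]
  constructor
  · rintro ⟨u, hu, rfl⟩
    rw [LinearEquiv.coe_coe, h u hu]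
    exact hu
  · exact fun hv => ⟨v, hv, h v hv⟩

theorem map_eq_self_of_le [FiniteDimensional K V] {g : V ≃ₗ[K] V} {U : Submodule K V}
    (h : ∀ u ∈ U, g u ∈ U) : U.map (g : V →ₗ[K] V) = U := by
  refine Submodule.eq_of_le_of_finrank_eq ?_ (LinearEquiv.finrank_map_eq g U)
  rintro _ ⟨u, hu, rfl⟩
  exact h u hu

variable {n : ℕ}

theorem MaxFlag.smul_space (g : F.isometryGroup) (c : F.MaxFlag n) (i : Fin (n + 1)) :
    (g • c).space i = (c.space i).map (g.1 : V →ₗ[K] V) := rfl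

/-- Induction on k: when the flags agree up to dimension k, their next members are matched by an
isometry fixing the common member pointwise, hence all smaller members too. -/
theorem MaxFlag.exists_smul_space_eq [Finite K] [FiniteDimensional K V] (c d : F.MaxFlag n)
    (k : ℕ) (hk : k ≤ n) : ∃ g : F.isometryGroup, ∀ i : Fin (n + 1), (i : ℕ) ≤ k →
      (g • c).space i = d.space i := by
  induction k with
  | zero =>
    refine ⟨1, fun i hi => ?_⟩
    have h1 := (((1 : F.isometryGroup) • c)).rank_eq i
    have h2 := d.rank_eq i
    rw [Nat.le_zero.1 hi, Submodule.finrank_eq_zero] at h1 h2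
    rw [h1, h2]
  | succ k ih =>
    obtain ⟨g, hg⟩ := ih (by omega)
    set c' := g • c with hc'
    let i : Fin (n + 1) := ⟨k, by omega⟩
    let j : Fin (n + 1) := ⟨k + 1, by omega⟩
    have hij : i ≤ j := Fin.mk_le_mk.2 (Nat.le_succ k)
    have hU := hg i le_rfl
    have hr : ∀ d : F.MaxFlag n, finrank K (d.space j) = finrank K (d.space i) + 1 :=
      fun d => (d.rank_eq j).trans (congrArg (· + 1) (d.rank_eq i).symm)
    have hex : ∀ d : F.MaxFlag n, ∃ x ∈ d.space j, x ∉ d.space i := by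
      intro d
      by_contra! H
      have := Submodule.finrank_mono (R := K) (M := V) (s := d.space j) (t := d.space i) H
      have := hr d
      omega
    obtain ⟨x, hx, hx'⟩ := hex c'
    obtain ⟨y, hy, hy'⟩ := hex d
    obtain ⟨h, hxy, hfix⟩ := exists_isometry_fix (F := F) (x := x) (y := y) (d.singular i)
      ((c'.singular j).norm_eq_zero hx) ((d.singular j).norm_eq_zero hy)
      (hU ▸ F.perp_anti (c'.mono hij) ((c'.singular j).le_perp hx))
      (F.perp_anti (d.mono hij) ((d.singular j).le_perp hy)) (hU ▸ hx') hy'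
    refine ⟨h * g, fun l hl => ?_⟩
    rw [mul_smul, ← hc', smul_space]
    rcases Nat.lt_or_ge k l with hlt | hge
    · obtain rfl : l = j := Fin.ext (by change (l : ℕ) = k + 1; omega)
      rw [← Submodule.sup_span_eq_of_finrank_eq (c'.mono hij) (hr c') hx hx',
        ← Submodule.sup_span_eq_of_finrank_eq (d.mono hij) (hr d) hy hy', Submodule.map_sup,
        hU, map_eq_self_of_fix hfix, Submodule.map_span, Set.image_singleton]
      congr 3
    · rw [hg l hge]
      exact map_eq_self_of_fix fun u hu => hfix u (d.mono (Fin.mk_le_mk.2 hge) hu)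

/-- The isometry group is transitive on maximal flags. -/
theorem MaxFlag.exists_smul_eq [Finite K] [FiniteDimensional K V] (c d : F.MaxFlag n) :
    ∃ g : F.isometryGroup, g • c = d := by
  obtain ⟨g, hg⟩ := c.exists_smul_space_eq d n le_rfl
  exact ⟨g, MaxFlag.ext (funext fun i => hg i (Nat.lt_succ_iff.1 i.2))⟩

end Transitivity

end PolarForm

/-! ### Types of points, and the stabilizer of a maximal flag. -/

namespace PolarForm

section Types

variable {K V : Type*} [Field K] [AddCommGroup V] [Module K V] {F : PolarForm K V} {n : ℕ}

theorem IsPoint.exists_eq_span {X : Submodule K V} (hX : F.IsPoint X) :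
    ∃ x, x ≠ 0 ∧ F.norm x = 0 ∧ X = K ∙ x := by
  obtain ⟨⟨x, hx⟩, h0, h⟩ := finrank_eq_one_iff'.1 hX.1
  refine ⟨x, fun h' => h0 (Subtype.ext h'), hX.2.norm_eq_zero hx, le_antisymm (fun y hy => ?_)
    ((Submodule.span_singleton_le_iff_mem x X).2 hx)⟩
  obtain ⟨a, ha⟩ := h ⟨y, hy⟩
  exact Submodule.mem_span_singleton.2 ⟨a, congrArg Subtype.val ha⟩

theorem isPoint_span {x : V} (hx : F.norm x = 0) (h0 : x ≠ 0) : F.IsPoint (K ∙ x) :=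
  ⟨finrank_span_singleton h0, totallySingular_span hx⟩

theorem IsPoint.ne_bot {X : Submodule K V} (hX : F.IsPoint X) : X ≠ ⊥ := by
  rintro rfl
  simpa using hX.1

theorem perp_map (g : F.isometryGroup) (U : Submodule K V) :
    F.perp (U.map (g.1 : V →ₗ[K] V)) = (F.perp U).map (g.1 : V →ₗ[K] V) := by
  have key : ∀ x, g.1 ((g⁻¹).1 x) = x := fun x => LinearEquiv.apply_symm_apply g.1 x
  have key' : ∀ x, (g⁻¹).1 (g.1 x) = x := fun x => LinearEquiv.symm_apply_apply g.1 x
  ext y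
  constructor
  · intro hy
    refine ⟨(g⁻¹).1 y, fun x hx => ?_, key y⟩
    have h1 : F.Orth (g.1 x) y := hy (g.1 x) ⟨x, hx, rfl⟩
    simpa only [key'] using F.orth_map g⁻¹ h1
  · rintro ⟨y, hy, rfl⟩ _ ⟨x, hx, rfl⟩
    exact F.orth_map g (hy x hx)

namespace MaxFlag

variable (c : F.MaxFlag n)

theorem chain_of_le {k : ℕ} (hk : k ≤ n) : c.chain k = c.space ⟨k, by omega⟩ := by
  rw [chain, dif_pos hk]

theorem space_eq_chain (i : Fin (n + 1)) : c.space i = c.chain i :=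
  (c.chain_of_le (Nat.lt_succ_iff.1 i.2)).symm

theorem chain_of_lt {k : ℕ} (hk : n < k) : c.chain k = F.perp (c.chain (2 * n - k)) := by
  rw [chain, dif_neg (by omega), c.chain_of_le (by omega)]

theorem finrank_chain {k : ℕ} (hk : k ≤ n) : finrank K (c.chain k) = k := by
  rw [c.chain_of_le hk, c.rank_eq]

theorem totallySingular_chain {k : ℕ} (hk : k ≤ n) : F.TotallySingular (c.chain k) := by
  rw [c.chain_of_le hk]
  exact c.singular _

theorem chain_mono : Monotone c.chain := by
  have h1 : ∀ k l, k ≤ l → l ≤ n → c.chain k ≤ c.chain l := by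
    intro k l hkl hl
    rw [c.chain_of_le hl, c.chain_of_le (hkl.trans hl)]
    exact c.mono (Fin.mk_le_mk.2 hkl)
  intro k l hkl
  rcases le_or_gt l n with hl | hl
  · exact h1 k l hkl hl
  rw [c.chain_of_lt hl]
  rcases le_or_gt k n with hk | hk
  · exact ((h1 k n hk le_rfl).trans (c.totallySingular_chain le_rfl).le_perp).trans
      (F.perp_anti (h1 _ n (by omega) le_rfl))
  · rw [c.chain_of_lt hk]
    exact F.perp_anti (h1 _ _ (by omega) (by omega))

theorem chain_smul (g : F.isometryGroup) (k : ℕ) :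
    (g • c).chain k = (c.chain k).map (g.1 : V →ₗ[K] V) := by
  unfold chain
  split_ifs
  · rfl
  · rw [smul_space, perp_map]

theorem type_smul (g : F.isometryGroup) (X : Submodule K V) :
    (g • c).type (X.map (g.1 : V →ₗ[K] V)) = c.type X := by
  unfold type
  congr 1
  ext k
  simp only [Set.mem_ofPred_eq, chain_smul]
  rw [Submodule.map_le_map_iff_of_injective (f := (g.1 : V →ₗ[K] V)) g.1.injective]

variable [FiniteDimensional K V]

theorem chain_zero : c.chain 0 = ⊥ :=
  Submodule.finrank_eq_zero.1 (c.finrank_chain (Nat.zero_le n))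

theorem chain_two_mul (hn : 0 < n) : c.chain (2 * n) = ⊤ := by
  rw [c.chain_of_lt (by omega), Nat.sub_self, chain_zero, perp_bot]

theorem type_eq_iff (hn : 0 < n) {X : Submodule K V} (hX : X ≠ ⊥) {i : ℕ} (hi : 1 ≤ i) :
    c.type X = i ↔ X ≤ c.chain i ∧ ¬ X ≤ c.chain (i - 1) := by
  have hne : {k | 1 ≤ k ∧ X ≤ c.chain k}.Nonempty :=
    ⟨2 * n, by omega, by rw [c.chain_two_mul hn]; exact le_top⟩
  have hmem := Nat.sInf_mem hne
  constructor
  · rintro rfl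
    refine ⟨hmem.2, fun h => ?_⟩
    rcases Nat.eq_zero_or_pos (c.type X - 1) with h0 | h0
    · rw [h0, chain_zero] at h
      exact hX (le_bot_iff.1 h)
    · exact Nat.notMem_of_lt_sInf (show c.type X - 1 < c.type X by omega) ⟨h0, h⟩
  · rintro ⟨h1, h2⟩
    refine le_antisymm (Nat.sInf_le ⟨hi, h1⟩) ?_
    by_contra! hlt
    exact h2 (hmem.2.trans (c.chain_mono (show c.type X ≤ i - 1 by omega)))

theorem type_mem_Icc (hn : 0 < n) (X : Submodule K V) : c.type X ∈ Finset.Icc 1 (2 * n) := by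
  have h2 : 2 * n ∈ {k | 1 ≤ k ∧ X ≤ c.chain k} :=
    ⟨by omega, by rw [c.chain_two_mul hn]; exact le_top⟩
  exact Finset.mem_Icc.2 ⟨(Nat.sInf_mem ⟨_, h2⟩).1, Nat.sInf_le h2⟩

theorem smul_eq_self_of_le {g : F.isometryGroup}
    (h : ∀ k ≤ n, ∀ v ∈ c.chain k, g.1 v ∈ c.chain k) : g • c = c := by
  refine MaxFlag.ext (funext fun i => ?_)
  rw [smul_space, space_eq_chain]
  exact map_eq_self_of_le (h i (Nat.lt_succ_iff.1 i.2))

theorem mem_chain_of_mem_perp (hr : F.HasRank n) {x : V} (hx : F.norm x = 0)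
    (h : x ∈ F.perp (c.chain n)) : x ∈ c.chain n := by
  by_contra h'
  have hS : F.TotallySingular (c.chain n ⊔ (K ∙ x)) :=
    (c.totallySingular_chain le_rfl).sup (totallySingular_span hx)
      ((Submodule.span_singleton_le_iff_mem _ _).2 h)
  have := hr.2 ⟨_, hS, rfl⟩
  rw [Submodule.finrank_sup_span h', c.finrank_chain le_rfl] at this
  omega

theorem sup_span_eq_chain {k : ℕ} (hk : k + 1 ≤ n) {x : V} (hx : x ∈ c.chain (k + 1))
    (hx' : x ∉ c.chain k) : c.chain k ⊔ (K ∙ x) = c.chain (k + 1) :=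
  Submodule.sup_span_eq_of_finrank_eq (c.chain_mono (Nat.le_succ k))
    (by rw [c.finrank_chain hk, c.finrank_chain (by omega)]) hx hx'

/-- The stabilizer of a maximal flag is transitive on the points in the lower half of a type. -/
theorem exists_smul_eq_self_of_le [Finite K] {k : ℕ} (hk : k + 1 ≤ n) {x x' : V}
    (hx : x ∈ c.chain (k + 1)) (hxk : x ∉ c.chain k) (hx' : x' ∈ c.chain (k + 1))
    (hxk' : x' ∉ c.chain k) :
    ∃ g : F.isometryGroup, g • c = c ∧ ∃ a : K, a ≠ 0 ∧ g.1 x = a • x' := by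
  have hts := c.totallySingular_chain hk
  obtain ⟨u, hu, v, hv, huv⟩ := Submodule.mem_sup.1
    ((c.sup_span_eq_chain hk hx hxk).symm ▸ hx')
  obtain ⟨a, rfl⟩ := Submodule.mem_span_singleton.1 hv
  have ha : a ≠ 0 := by
    rintro rfl
    rw [zero_smul, add_zero] at huv
    exact hxk' (huv ▸ hu)
  obtain ⟨f, hfx, hf⟩ := (c.chain k).exists_le_ker_of_notMem hxk
  have hxx : a⁻¹ • x' - x = a⁻¹ • u := by
    rw [← huv, smul_add, inv_smul_smul₀ ha]
    abel
  have hmem : a⁻¹ • x' - x ∈ c.chain k := hxx ▸ (c.chain k).smul_mem _ hu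
  have hmem' : a⁻¹ • x' - x ∈ c.chain (k + 1) := c.chain_mono (Nat.le_succ k) hmem
  have hfx' : f (a⁻¹ • x') = f x := by
    have : f (a⁻¹ • x' - x) = 0 := hf hmem
    rwa [map_sub, sub_eq_zero] at this
  -- The axis z is orthogonal to the k-th member and has product 1 with both x and the rescaled x'.
  obtain ⟨z, hz, hzf⟩ := exists_singular_form_eq hts ((f x)⁻¹ • f) hx
    (by simpa using hfx)
  have hx'' : a⁻¹ • x' ∈ c.chain (k + 1) := Submodule.smul_mem _ _ hx'
  obtain ⟨g, hg, hg'⟩ := F.exists_isometry_siegel (hts.norm_eq_zero hx)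
    (hts.norm_eq_zero hx'') hz (by simp [hzf x hx, hfx]) (by
      rw [hzf _ hx'', LinearMap.smul_apply, hfx', smul_eq_mul, inv_mul_cancel₀ hfx])
  refine ⟨g, c.smul_eq_self_of_le fun l hl v hv => ?_, a⁻¹, inv_ne_zero ha, hg⟩
  rw [hg', F.mem_perp'.1 (hts.le_perp hx'') x hx, zero_mul, zero_sub]
  have h1 : F.form (a⁻¹ • x' - x) v = 0 := by
    rcases le_total l (k + 1) with h | h
    · exact F.mem_perp'.1 (hts.le_perp hmem') v (c.chain_mono h hv)
    · exact F.mem_perp'.1 ((c.totallySingular_chain hl).le_perp (c.chain_mono h hmem')) v hv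
  rw [h1, neg_zero, mul_zero, zero_smul, add_zero]
  -- A member above k contains the difference of the two points; a member up to k is orthogonal to
  -- the axis.
  rcases Nat.lt_or_ge k l with h | h
  · exact add_mem hv (Submodule.smul_mem _ _ (c.chain_mono h.le hmem))
  · have h2 : F.form z v = 0 := by
      have hvk := c.chain_mono h hv
      have hfv : f v = 0 := hf hvk
      rw [hzf v (c.chain_mono (Nat.le_succ k) hvk)]
      simp [hfv]
    rwa [h2, zero_smul, add_zero]

/-- The stabilizer of a maximal flag is transitive on the points in the upper half of a type. -/
theorem exists_smul_eq_self_of_perp [Finite K] {k : ℕ} (hk : k + 1 ≤ n) {x x' : V}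
    (hx0 : F.norm x = 0) (hx0' : F.norm x' = 0)
    (hx : x ∈ F.perp (c.chain k)) (hxk : x ∉ F.perp (c.chain (k + 1)))
    (hx' : x' ∈ F.perp (c.chain k)) (hxk' : x' ∉ F.perp (c.chain (k + 1))) :
    ∃ g : F.isometryGroup, g • c = c ∧ ∃ a : K, a ≠ 0 ∧ g.1 x = a • x' := by
  have hts := c.totallySingular_chain hk
  obtain ⟨y, hy, hyx⟩ : ∃ y ∈ c.chain (k + 1), F.form y x ≠ 0 := by
    by_contra! H
    exact hxk (F.mem_perp.2 H)
  have hyk : y ∉ c.chain k := fun h => hyx (F.mem_perp.1 hx y h)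
  have hyx' : F.form y x' ≠ 0 := by
    intro h0
    refine hxk' ?_
    rw [← c.sup_span_eq_chain hk hy hyk, perp_sup]
    exact ⟨hx', F.mem_perp_span.2 h0⟩
  -- The conjugate appears because the form is semilinear in its first argument.
  set b := (F.conj (F.form y x))⁻¹ with hb
  have hcb : F.conj b * F.form y x = 1 := by
    rw [hb, map_inv₀, conj_conj, inv_mul_cancel₀ hyx]
  have hb0 : F.conj b ≠ 0 := left_ne_zero_of_mul_eq_one hcb
  have hy1 : F.form (b • y) x = 1 := by rw [form_smul_left, hcb]
  have hy1' : F.form (b • y) x' ≠ 0 := by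
    rw [form_smul_left]
    exact mul_ne_zero hb0 hyx'
  have hby : b • y ∈ c.chain (k + 1) := Submodule.smul_mem _ _ hy
  generalize b • y = w at hy1 hy1' hby
  set a := (F.form w x')⁻¹ with ha
  have hax' : a • x' ∈ F.perp (c.chain k) := Submodule.smul_mem _ _ hx'
  obtain ⟨g, hg, hg'⟩ := F.exists_isometry_siegel (x' := a • x') hx0
    (by rw [norm_smul, hx0', mul_zero]) (hts.norm_eq_zero hby) hy1
    (by rw [map_smul, smul_eq_mul, ha, inv_mul_cancel₀ hy1'])
  refine ⟨g, c.smul_eq_self_of_le fun l hl v hv => ?_, a, inv_ne_zero hy1', hg⟩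
  rw [hg']
  have h1 : F.form w v = 0 := by
    rcases le_total l (k + 1) with h | h
    · exact F.mem_perp'.1 (hts.le_perp hby) v (c.chain_mono h hv)
    · exact F.mem_perp'.1 ((c.totallySingular_chain hl).le_perp (c.chain_mono h hby)) v hv
  rw [h1, zero_smul, add_zero, mul_zero, zero_sub]
  -- The roles are now exchanged: a member above k contains the axis w, and one up to k is
  -- orthogonal to the difference of the points.
  rcases Nat.lt_or_ge k l with h | h
  · exact add_mem hv (Submodule.smul_mem _ _ (c.chain_mono h hby))
  · have hvk := c.chain_mono h hv
    have h2 : F.form (a • x' - x) v = 0 :=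
      F.mem_perp'.1 (sub_mem hax' hx) v hvk
    rwa [h2, neg_zero, mul_zero, zero_smul, add_zero]

/-- Only k + 1 = n needs an argument: the chain lists U_n but not its complement, and by maximality
these have the same singular vectors. -/
theorem perp_mem_iff_of_singular (hr : F.HasRank n) {k : ℕ} (hk : k + 1 ≤ n) {x : V}
    (hx : F.norm x = 0) : x ∈ F.perp (c.chain (k + 1)) ↔ x ∈ c.chain (2 * n - k - 1) := by
  rcases hk.eq_or_lt with h | h
  · rw [h, show 2 * n - k - 1 = n by omega]
    exact ⟨c.mem_chain_of_mem_perp hr hx,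
      fun hx => (c.totallySingular_chain le_rfl).le_perp hx⟩
  · rw [c.chain_of_lt (k := 2 * n - k - 1) (by omega),
      show 2 * n - (2 * n - k - 1) = k + 1 by omega]

/-- The stabilizer of a maximal flag is transitive on the points of a type. -/
theorem exists_smul_eq_self_map_eq [Finite K] (hn : 0 < n) (hr : F.HasRank n)
    {X X' : Submodule K V} (hX : F.IsPoint X) (hX' : F.IsPoint X') (h : c.type X = c.type X') :
    ∃ g : F.isometryGroup, g • c = c ∧ X.map (g.1 : V →ₗ[K] V) = X' := by
  obtain ⟨hi1, hi2⟩ := Finset.mem_Icc.1 (c.type_mem_Icc hn X')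
  have h1 := (c.type_eq_iff hn hX.ne_bot hi1).1 h
  have h2 := (c.type_eq_iff hn hX'.ne_bot hi1).1 rfl
  obtain ⟨x, hx0, hx, rfl⟩ := hX.exists_eq_span
  obtain ⟨x', hx0', hx', rfl⟩ := hX'.exists_eq_span
  generalize c.type (K ∙ x') = i at *
  simp only [Submodule.span_singleton_le_iff_mem] at h1 h2
  suffices ∃ g : F.isometryGroup, g • c = c ∧ ∃ a : K, a ≠ 0 ∧ g.1 x = a • x' by
    obtain ⟨g, hg, a, ha, hga⟩ := this
    refine ⟨g, hg, ?_⟩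
    rw [Submodule.map_span, Set.image_singleton, LinearEquiv.coe_coe, hga,
      Submodule.span_singleton_smul_eq ha.isUnit]
  rcases le_or_gt i n with hin | hin
  · obtain ⟨k, rfl⟩ : ∃ k, i = k + 1 := ⟨i - 1, by omega⟩
    exact c.exists_smul_eq_self_of_le hin h1.1 h1.2 h2.1 h2.2
  · obtain ⟨k, hk⟩ : ∃ k, i + k = 2 * n := ⟨2 * n - i, by omega⟩
    have e1 : 2 * n - i = k := by omega
    have e2 : i - 1 = 2 * n - k - 1 := by omega
    rw [c.chain_of_lt hin, e1, e2] at h1 h2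
    exact c.exists_smul_eq_self_of_perp (by omega) hx hx' h1.1
      (fun h => h1.2 ((c.perp_mem_iff_of_singular hr (by omega) hx).1 h)) h2.1
      (fun h => h2.2 ((c.perp_mem_iff_of_singular hr (by omega) hx').1 h))

/-- Two maximal flags are in the same orbit of the stabilizer of a point if and only if they have
the same type. -/
theorem exists_smul_eq_of_type_eq [Finite K] (hn : 0 < n) (hr : F.HasRank n) {X : Submodule K V}
    (hX : F.IsPoint X) {d : F.MaxFlag n} (h : c.type X = d.type X) :
    ∃ g ∈ F.stabilizer X, g • c = d := by
  -- With c = g • d, the points X and g X have the same type for c. An isometry fixing c and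
  -- carrying X to g X, followed by g⁻¹, stabilizes X and moves c to d.
  obtain ⟨g, rfl⟩ := d.exists_smul_eq c
  have hX' : F.IsPoint (X.map (g.1 : V →ₗ[K] V)) :=
    ⟨(LinearEquiv.finrank_map_eq g.1 X).trans hX.1, F.totallySingular_map g hX.2⟩
  obtain ⟨h', h1, h2⟩ := (g • d).exists_smul_eq_self_map_eq hn hr hX hX'
    (h.trans (d.type_smul g X).symm)
  refine ⟨g⁻¹ * h', ?_, by rw [mul_smul, h1, inv_smul_smul]⟩
  have e : X.map ((g⁻¹ * h').1 : V →ₗ[K] V)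
      = (X.map (h'.1 : V →ₗ[K] V)).map ((g⁻¹).1 : V →ₗ[K] V) :=
    Submodule.map_comp (h'.1 : V →ₗ[K] V) ((g⁻¹).1 : V →ₗ[K] V) X
  refine e.trans ?_
  rw [h2, ← Submodule.map_comp]
  convert Submodule.map_id X
  exact LinearMap.ext fun v => LinearEquiv.symm_apply_apply g.1 v

end MaxFlag

end Types

end PolarForm

/-! ### Singular vectors in intersections of members of opposite flags. -/

theorem AddMonoidHom.card_ker_comp_mul_card {G H L : Type*} [AddGroup G] [AddGroup H]
    [AddGroup L] (f : G →+ H) (hf : Function.Surjective f) (g : H →+ L) :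
    Nat.card (g.comp f).ker * Nat.card H = Nat.card G * Nat.card g.ker := by
  have h1 := AddSubgroup.card_mul_index (g.comp f).ker
  have h2 := AddSubgroup.card_mul_index g.ker
  -- Indices are compared, as g need not be surjective; in the application g is the trace.
  have h3 : (g.comp f).ker.index = g.ker.index := by
    rw [← AddMonoidHom.comap_ker]
    exact AddSubgroup.index_comap_of_surjective _ hf
  rw [h3] at h1
  rw [← h1, ← h2]
  ring

namespace PolarForm

section Counting

variable {K V : Type*} [Field K] [AddCommGroup V] [Module K V] (F : PolarForm K V)

/-- The number of singular vectors in a subspace. -/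
noncomputable def singCard (A : Submodule K V) : ℕ :=
  {v | v ∈ A ∧ F.norm v = 0}.ncard

variable {F}

theorem TotallySingular.singCard_eq {A : Submodule K V} (hA : F.TotallySingular A) :
    F.singCard A = Nat.card A := by
  rw [singCard, ← Nat.card_coe_set_eq]
  exact Nat.card_congr (Equiv.subtypeEquivRight fun v => and_iff_left_of_imp hA.norm_eq_zero)

/-- As E is totally singular, the condition on e reads tr (form v e) = -norm v. Its solutions are a
fibre of a homomorphism on E, nonempty since every norm is a trace. -/
theorem card_norm_add_eq_zero [Finite K] {E : Submodule K V} (hE : F.TotallySingular E) {v : V}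
    (hv : ∃ e ∈ E, F.form v e ≠ 0) :
    Nat.card {e : E // F.norm (v + e) = 0} * Nat.card K = Nat.card E * Nat.card F.tr.ker := by
  obtain ⟨e₁, he₁, hve⟩ := hv
  let l : E →+ K := ((F.form v).comp E.subtype).toAddMonoidHom
  have hl : ∀ a, l ((a * (F.form v e₁)⁻¹) • ⟨e₁, he₁⟩) = a := by
    intro a
    change F.form v ((a * (F.form v e₁)⁻¹) • e₁) = a
    rw [map_smul, smul_eq_mul, inv_mul_cancel_right₀ hve]
  have hs : Function.Surjective l := fun a => ⟨_, hl a⟩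
  rw [← AddMonoidHom.card_ker_comp_mul_card l hs F.tr]
  congr 1
  obtain ⟨a, ha⟩ := F.exists_tr_eq_norm v
  obtain ⟨e₀, he₀⟩ := hs (-a)
  rw [← AddMonoidHom.card_fiber _ e₀]
  refine Nat.card_congr (Equiv.subtypeEquivRight fun e => ?_)
  rw [norm_add, hE.norm_eq_zero e.2, add_zero, AddMonoidHom.comp_apply, AddMonoidHom.comp_apply,
    he₀, map_neg, ha, add_comm]
  exact add_eq_zero_iff_eq_neg

/-- In a set of vectors invariant under translation by a totally singular subspace to which no
vector of the set is orthogonal, the proportion of singular vectors is known. -/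
theorem ncard_singular_mul_card [Finite K] [FiniteDimensional K V] {E : Submodule K V}
    (hE : F.TotallySingular E) {S : Set V} (hS : ∀ v ∈ S, ∀ e ∈ E, v + e ∈ S)
    (h : ∀ v ∈ S, ∃ e ∈ E, F.form v e ≠ 0) :
    {v | v ∈ S ∧ F.norm v = 0}.ncard * Nat.card K = S.ncard * Nat.card F.tr.ker := by
  have : Finite V := Module.finite_of_finite K
  have := Fintype.ofFinite S
  have h1 : Nat.card {p : S × E // F.norm (p.1 + p.2) = 0} * Nat.card K
      = S.ncard * (Nat.card E * Nat.card F.tr.ker) := by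
    rw [Nat.card_congr (Equiv.subtypeProdEquivSigmaSubtype
      (fun (v : S) (e : E) => F.norm (v + e) = 0)), Nat.card_sigma, Finset.sum_mul,
      Finset.sum_congr rfl fun (v : S) _ => card_norm_add_eq_zero hE (h v v.2), Finset.sum_const,
      smul_eq_mul, Finset.card_univ, ← Nat.card_eq_fintype_card, Nat.card_coe_set_eq]
  -- The substitution (v, e) ↦ (v + e, e) turns the pairs into a product.
  have h2 : Nat.card {p : S × E // F.norm (p.1 + p.2) = 0}
      = {v | v ∈ S ∧ F.norm v = 0}.ncard * Nat.card E := by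
    rw [← Nat.card_coe_set_eq, ← Nat.card_prod]
    refine Nat.card_congr
      { toFun := fun p => ⟨⟨p.1.1 + p.1.2, hS _ p.1.1.2 _ p.1.2.2, p.2⟩, p.1.2⟩
        invFun := fun p => ⟨⟨⟨p.1.1 - p.2, ?_⟩, p.2⟩, ?_⟩
        left_inv := fun p => by simp
        right_inv := fun p => by simp }
    · rw [sub_eq_add_neg]
      exact hS _ p.1.2.1 _ (neg_mem p.2.2)
    · simpa using p.1.2.2
  rw [h2] at h1
  have h3 : 0 < Nat.card E := Nat.card_pos
  refine Nat.eq_of_mul_eq_mul_right h3 ?_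
  linarith

theorem Opposite.symm {U W : Submodule K V} (h : F.Opposite U W) : F.Opposite W U := ⟨h.2, h.1⟩

theorem Opposite.eq_zero {U W : Submodule K V} (h : F.Opposite U W) {x : V} (hx : x ∈ U)
    (hx' : x ∈ F.perp W) : x = 0 :=
  (Submodule.mem_bot K).1 (h.1 ▸ Submodule.mem_inf.2 ⟨hx, hx'⟩)

/-- The two codimensions add up: a vector of W orthogonal to the complement of U' is orthogonal to
U, since U ≤ U' ≤ `F.perp U'`, and so it is zero by opposition. -/
theorem card_perp_inf_perp_mul [Finite K] [FiniteDimensional K V] {U U' W : Submodule K V}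
    (h : F.Opposite U W) (hU : U ≤ U') (hU' : F.TotallySingular U') :
    Nat.card (F.perp U' ⊓ F.perp W : Submodule K V) * Nat.card W * Nat.card U' = Nat.card V := by
  rw [card_inf_perp_mul_card (F := F), card_perp_mul_card hU']
  intro x hx hx'
  refine h.symm.eq_zero hx (F.perp_anti ?_ hx')
  exact hU.trans hU'.le_perp

/-- The parameter `q ^ (e - 1)` of the polar space. -/
noncomputable def weight (F : PolarForm K V) (n : ℕ) : ℝ :=
  (Nat.card V : ℝ) * Nat.card F.tr.ker / (Nat.card K : ℝ) ^ (2 * n + 1)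

variable [Finite K] [FiniteDimensional K V] {n : ℕ}

theorem MaxFlag.card_chain (c : F.MaxFlag n) {k : ℕ} (hk : k ≤ n) :
    Nat.card (c.chain k) = Nat.card K ^ k := by
  rw [Module.natCard_eq_pow_finrank_of_field K, c.finrank_chain hk]

/-- All vectors of the intersection are singular because i ≤ n. For i + k ≤ 2n it is trivial by
opposition, and the truncated exponent 0 counts the zero vector. -/
theorem singCard_chain_inf_chain_of_le {c d : F.MaxFlag n}
    (h : ∀ k ≤ n, F.Opposite (c.chain k) (d.chain k)) {i k : ℕ} (hi : i ≤ n) (hk : k ≤ 2 * n) :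
    F.singCard (c.chain i ⊓ d.chain k) = Nat.card K ^ (i + k - 2 * n) := by
  rw [((c.totallySingular_chain hi).mono inf_le_left).singCard_eq]
  have hbot : ∀ m ≤ n, ∀ A ≤ c.chain m, ∀ B ≤ F.perp (d.chain m),
      Nat.card (A ⊓ B : Submodule K V) = 1 := by
    intro m hm A hA B hB
    have : A ⊓ B = ⊥ := le_bot_iff.1 ((h m hm).1 ▸ inf_le_inf hA hB)
    rw [this]
    simp
  rcases le_or_gt k n with hkn | hkn
  · rw [show i + k - 2 * n = 0 by omega, pow_zero]
    exact hbot n le_rfl _ (c.chain_mono hi) _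
      ((d.chain_mono hkn).trans (d.totallySingular_chain le_rfl).le_perp)
  rw [d.chain_of_lt hkn]
  obtain ⟨m, hm⟩ : ∃ m, m + k = 2 * n := ⟨2 * n - k, by omega⟩
  rw [show 2 * n - k = m by omega]
  rcases le_total i m with him | him
  · rw [show i + k - 2 * n = 0 by omega, pow_zero]
    exact hbot m (by omega) _ (c.chain_mono him) _ le_rfl
  · have := card_inf_perp_mul_card (F := F) (A := c.chain i) (B := d.chain m) fun x hx hx' =>
      (h m (by omega)).symm.eq_zero hx (F.perp_anti (c.chain_mono him) hx')
    rw [c.card_chain hi, d.card_chain (by omega)] at this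
    refine Nat.eq_of_mul_eq_mul_right (pow_pos (Nat.card_pos (α := K)) m) ?_
    rw [this, ← pow_add]
    congr 1
    omega

/-- The vectors of A outside A' are counted by `ncard_singular_mul_card`, with translations by E.
The singular vectors of A' are exactly those of E, by maximality of the n-th member. -/
theorem singCard_perp_inf_perp (hr : F.HasRank n) {c d : F.MaxFlag n}
    (h : ∀ k ≤ n, F.Opposite (c.chain k) (d.chain k)) {m m' : ℕ} (hm : m ≤ m') (hm' : m' ≤ n) :
    (F.singCard (F.perp (c.chain m') ⊓ F.perp (d.chain m)) : ℝ)
      = (Nat.card K : ℝ) ^ (n - m) * (1 + ((Nat.card K : ℝ) ^ (n - m') - 1) * F.weight n) := by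
  have : Finite V := Module.finite_of_finite K
  set A := F.perp (c.chain m') ⊓ F.perp (d.chain m) with hA
  set A' := F.perp (c.chain n) ⊓ F.perp (d.chain m) with hA'
  have hAA' : A' ≤ A := inf_le_inf_right _ (F.perp_anti (c.chain_mono hm'))
  have hopp := h m (hm.trans hm')
  have hcn := c.totallySingular_chain (le_refl n)
  set E := c.chain n ⊓ F.perp (d.chain m) with hE
  have hEts : F.TotallySingular E := hcn.mono inf_le_left
  have hEA : E ≤ A := (inf_le_inf_right _ hcn.le_perp).trans hAA'
  have hcardE : Nat.card E = Nat.card K ^ (n - m) := by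
    have := card_inf_perp_mul_card (F := F) (A := c.chain n) (B := d.chain m) fun x hx hx' =>
      hopp.symm.eq_zero hx (F.perp_anti (c.chain_mono (hm.trans hm')) hx')
    rw [c.card_chain le_rfl, d.card_chain (by omega)] at this
    refine Nat.eq_of_mul_eq_mul_right (pow_pos (Nat.card_pos (α := K)) m) ?_
    rw [this, ← pow_add]
    congr 1
    omega
  have hcardA := card_perp_inf_perp_mul hopp (c.chain_mono hm) (c.totallySingular_chain hm')
  have hcardA' := card_perp_inf_perp_mul hopp (c.chain_mono (hm.trans hm')) hcn
  rw [← hA, d.card_chain (by omega), c.card_chain hm'] at hcardA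
  rw [← hA', d.card_chain (by omega), c.card_chain le_rfl] at hcardA'
  -- By opposition E meets the m-th member trivially, and its dimension is n - m. Since A is
  -- orthogonal to the m-th member, a vector of A orthogonal to E is orthogonal to the whole n-th
  -- member.
  have hsup : c.chain m ⊔ E = c.chain n := by
    refine Submodule.eq_of_le_of_finrank_eq
      (sup_le (c.chain_mono (hm.trans hm')) inf_le_left) ?_
    have h1 := Submodule.finrank_sup_add_finrank_inf_eq (c.chain m) E
    have h2 : c.chain m ⊓ E = ⊥ :=
      le_bot_iff.1 (hopp.1 ▸ le_inf inf_le_left (inf_le_right.trans inf_le_right))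
    rw [Module.natCard_eq_pow_finrank_of_field K E] at hcardE
    have h3 := Nat.pow_right_injective (Finite.one_lt_card (α := K)) hcardE
    rw [h2, finrank_bot, c.finrank_chain (by omega)] at h1
    rw [c.finrank_chain le_rfl]
    omega
  have hperp : ∀ v ∈ A, v ∈ F.perp E → v ∈ A' := by
    intro v hv hvE
    refine ⟨?_, hv.2⟩
    rw [← hsup, perp_sup]
    exact ⟨F.perp_anti (c.chain_mono hm) hv.1, hvE⟩
  have hcount := ncard_singular_mul_card hEts (S := (A : Set V) \ A')
    (fun v hv e he => ⟨add_mem hv.1 (hEA he), fun h' => hv.2 (by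
      simpa using sub_mem h' (inf_le_inf_right _ hcn.le_perp he : e ∈ A'))⟩)
    (fun v hv => by
      by_contra! H
      exact hv.2 (hperp v hv.1 (F.mem_perp'.2 H)))
  have hdiff : ((A : Set V) \ A').ncard + Nat.card A' = Nat.card A := by
    have := Set.ncard_sdiff_add_ncard_of_subset (s := (A' : Set V)) (t := A) hAA' (Set.toFinite _)
    rwa [← Nat.card_coe_set_eq (A : Set V), ← Nat.card_coe_set_eq (A' : Set V)] at this
  have hsplit : F.singCard A
      = {v | v ∈ (A : Set V) \ A' ∧ F.norm v = 0}.ncard + Nat.card E := by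
    have hsub : (E : Set V) ⊆ {v | v ∈ A ∧ F.norm v = 0} :=
      fun v hv => ⟨hEA hv, hEts.norm_eq_zero hv⟩
    have := Set.ncard_sdiff_add_ncard_of_subset hsub (Set.toFinite _)
    rw [singCard, ← this, ← Nat.card_coe_set_eq (E : Set V)]
    congr 2
    ext v
    simp only [Set.mem_sdiff, Set.mem_ofPred_eq, SetLike.mem_coe]
    refine ⟨fun ⟨⟨h1, h2⟩, h3⟩ => ⟨⟨h1, fun h4 => h3 ⟨?_, h4.2⟩⟩, h2⟩,
      fun ⟨⟨h1, h3⟩, h2⟩ => ⟨⟨h1, h2⟩, fun h4 => h3 ⟨hcn.le_perp h4.1, h4.2⟩⟩⟩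
    exact c.mem_chain_of_mem_perp hr h2 h4.1
  have hq : (Nat.card K : ℝ) ≠ 0 := by exact_mod_cast Nat.card_pos.ne'
  obtain ⟨a, rfl⟩ := Nat.exists_eq_add_of_le hm
  obtain ⟨b, rfl⟩ := Nat.exists_eq_add_of_le hm'
  rw [hsplit, hcardE, weight, ← hcardA']
  have e1 : (Nat.card A : ℝ) = Nat.card A' * (Nat.card K : ℝ) ^ b := by
    have : (Nat.card A : ℝ) * (Nat.card K : ℝ) ^ m * (Nat.card K : ℝ) ^ (m + a)
      = Nat.card A' * (Nat.card K : ℝ) ^ m * (Nat.card K : ℝ) ^ (m + a + b) := by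
      exact_mod_cast hcardA.trans hcardA'.symm
    have h0 : (Nat.card K : ℝ) ^ m * (Nat.card K : ℝ) ^ (m + a) ≠ 0 := by positivity
    refine mul_right_cancel₀ h0 ?_
    rw [← mul_assoc, this]
    ring
  have e2 : ({v | v ∈ (A : Set V) \ A' ∧ F.norm v = 0}.ncard : ℝ) * Nat.card K
      = (Nat.card A - Nat.card A') * Nat.card F.tr.ker := by
    rw [← hdiff]
    push_cast
    rw [add_sub_cancel_right]
    exact_mod_cast hcount
  rw [e1] at e2
  push_cast
  rw [eq_div_of_mul_eq hq e2, show m + a + b - m = a + b by omega,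
    show m + a + b - (m + a) = b by omega]
  field_simp
  ring

end Counting

end PolarForm

/-! ### The degree of the opposition graph. -/

namespace PolarForm

section OppositeFlags

variable {K V : Type*} [Field K] [AddCommGroup V] [Module K V] {F : PolarForm K V} {n : ℕ}

theorem opposite_bot_bot : F.Opposite ⊥ ⊥ := ⟨bot_inf_eq _, bot_inf_eq _⟩

theorem totallySingular_bot : F.TotallySingular (⊥ : Submodule K V) := by
  rw [totallySingular_iff]
  intro x hx
  rw [(Submodule.mem_bot K).1 hx]
  exact ⟨by simpa using F.norm_smul 0 0, by simp⟩

theorem MaxFlag.adj_iff (hn : 0 < n) (c d : F.MaxFlag n) :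
    (F.oppositionGraph n).Adj c d ↔ ∀ k ≤ n, F.Opposite (c.chain k) (d.chain k) := by
  constructor
  · intro h k hk
    rw [c.chain_of_le hk, d.chain_of_le hk]
    exact h.2 _
  · intro h
    refine ⟨?_, fun i => ?_⟩
    · rintro rfl
      have h1 := (h n le_rfl).1
      rw [inf_eq_left.2 (c.totallySingular_chain le_rfl).le_perp] at h1
      have h2 := c.finrank_chain (le_refl n)
      rw [h1, finrank_bot] at h2
      omega
    · rw [space_eq_chain, space_eq_chain]
      exact h i (Nat.lt_succ_iff.1 i.2)

/-- The initial segments, with members up to dimension `k`, of maximal flags opposite to `c`. -/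
def PartialOpposite (c : F.MaxFlag n) (k : ℕ) : Type _ :=
  {d : Fin (k + 1) → Submodule K V // (∀ i : Fin k, d i.castSucc ≤ d i.succ) ∧
    (∀ i, finrank K (d i) = i) ∧ (∀ i, F.TotallySingular (d i)) ∧
    ∀ i : Fin (k + 1), F.Opposite (c.chain i) (d i)}

variable [FiniteDimensional K V]

theorem card_partialOpposite_zero (c : F.MaxFlag n) : Nat.card (PartialOpposite c 0) = 1 := by
  rw [Nat.card_eq_one_iff_unique]
  refine ⟨⟨fun d d' => Subtype.ext (funext fun i => ?_)⟩, ⟨fun _ => ⊥, fun i => i.elim0,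
    fun i => ?_, fun _ => totallySingular_bot, fun i => ?_⟩⟩
  · have h1 := d.2.2.1 i
    have h2 := d'.2.2.1 i
    rw [Fin.fin_one_eq_zero i] at h1 h2 ⊢
    rw [Submodule.finrank_eq_zero.1 h1, Submodule.finrank_eq_zero.1 h2]
  · rw [Fin.fin_one_eq_zero i]
    simp
  · rw [Fin.fin_one_eq_zero i, Fin.val_zero, c.chain_zero]
    exact opposite_bot_bot

variable [Finite K]

/-- One half of opposition implies the other: |U ∩ W^⊥| * |W| = |U|, and the dimensions agree. -/
theorem opposite_of_finrank_eq {U W : Submodule K V} (hr : finrank K U = finrank K W)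
    (h : ∀ x ∈ W, x ∈ F.perp U → x = 0) : F.Opposite U W := by
  have h1 := card_inf_perp_mul_card h
  rw [Module.natCard_eq_pow_finrank_of_field K W, Module.natCard_eq_pow_finrank_of_field K U,
    hr] at h1
  have h2 : Nat.card (U ⊓ F.perp W : Submodule K V) = 1 :=
    Nat.eq_of_mul_eq_mul_right (pow_pos (Nat.card_pos (α := K)) (finrank K W)) (by rw [h1, one_mul])
  refine ⟨?_, le_bot_iff.1 fun x hx => h x hx.1 hx.2⟩
  rw [Nat.card_eq_one_iff_unique] at h2
  exact (Submodule.subsingleton_iff_eq_bot).1 h2.1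

/-- The number of extensions of a totally singular subspace opposite to `U` to one opposite to
`U'`, where `U` is a hyperplane of `U'`. -/
theorem card_opposite_extensions {U U' W : Submodule K V} (hUU' : U ≤ U')
    (hU' : F.TotallySingular U') (hr : finrank K U' = finrank K U + 1)
    (hW : F.TotallySingular W) (hrW : finrank K W = finrank K U) (hopp : F.Opposite U W) :
    Nat.card {W' : Submodule K V // W ≤ W' ∧ finrank K W' = finrank K W + 1 ∧
        F.TotallySingular W' ∧ F.Opposite U' W'} * Nat.card K ^ (2 * finrank K U + 2)
      = Nat.card V * Nat.card F.tr.ker := by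
  have : Finite V := Module.finite_of_finite K
  have hq := Finite.one_lt_card (α := K)
  have hcU := Module.natCard_eq_pow_finrank_of_field K U
  have hcU' := Module.natCard_eq_pow_finrank_of_field K U'
  have hcW := Module.natCard_eq_pow_finrank_of_field K W
  rw [hr] at hcU'
  rw [hrW] at hcW
  have hU : F.TotallySingular U := hU'.mono hUU'
  -- The part of S orthogonal to T has exactly q elements, and a nonzero one is not in Y because Y
  -- is opposite to T.
  have line : ∀ S T Y : Submodule K V, Nat.card T = Nat.card K ^ finrank K U →
      Nat.card S = Nat.card K ^ (finrank K U + 1) → (∀ x ∈ T, x ∈ F.perp S → x = 0) →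
      F.Opposite Y T → ∃ e ∈ S, e ∈ F.perp T ∧ e ∉ Y := by
    intro S T Y hT hS h hY
    have h1 := card_inf_perp_mul_card h
    rw [hT, hS, pow_succ'] at h1
    have h2 := Nat.eq_of_mul_eq_mul_right (pow_pos (by omega) _) h1
    obtain ⟨e, he, he0⟩ := Submodule.exists_mem_ne_zero_of_ne_bot
      (p := S ⊓ F.perp T) (by rintro h0; rw [h0] at h2; simp at h2; omega)
    exact ⟨e, he.1, he.2, fun hY' => he0 (hY.eq_zero hY' he.2)⟩
  obtain ⟨e, heU', heW, heU⟩ := line U' W U hcW hcU'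
    (fun x hx hx' => hopp.symm.eq_zero hx (F.perp_anti hUU' hx')) hopp
  have hspan := Submodule.sup_span_eq_of_finrank_eq hUU' hr heU' heU
  have he0 : F.norm e = 0 := hU'.norm_eq_zero heU'
  have heU2 : e ∈ F.perp U := F.perp_anti hUU' (hU'.le_perp heU')
  set A := F.perp U ⊓ F.perp W with hA
  set A' := F.perp U' ⊓ F.perp W with hA'
  have heA : e ∈ A := ⟨heU2, heW⟩
  have hmemA' : ∀ v, v ∈ A' ↔ v ∈ A ∧ F.form e v = 0 := by
    intro v
    rw [hA', ← hspan, perp_sup, Submodule.mem_inf, Submodule.mem_inf, mem_perp_span, hA,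
      Submodule.mem_inf]
    tauto
  have hcA := card_perp_inf_perp_mul hopp le_rfl hU
  have hcA' := card_perp_inf_perp_mul hopp hUU' hU'
  rw [← hA, hcU, hcW] at hcA
  rw [← hA', hcU', hcW] at hcA'
  obtain ⟨v₀, hv₀, hev₀⟩ : ∃ v ∈ A, F.form e v = 1 := by
    obtain ⟨v, hv, hev⟩ : ∃ v ∈ A, F.form e v ≠ 0 := by
      by_contra! H
      have hAA' : A = A' := le_antisymm (fun v hv => (hmemA' v).2 ⟨hv, H v hv⟩)
        fun v hv => ((hmemA' v).1 hv).1
      rw [← hAA', ← hcA] at hcA'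
      have h1 : 0 < Nat.card A * Nat.card K ^ finrank K U := by
        have : 0 < Nat.card A := Nat.card_pos
        positivity
      have := Nat.pow_right_injective hq (Nat.eq_of_mul_eq_mul_left h1 hcA')
      omega
    exact ⟨(F.form e v)⁻¹ • v, Submodule.smul_mem _ _ hv, by
      rw [map_smul, smul_eq_mul, inv_mul_cancel₀ hev]⟩
  set S : Set V := {v | v ∈ A ∧ F.form e v = 1} with hS
  have hcS : S.ncard = Nat.card A' := by
    rw [← Nat.card_coe_set_eq]
    refine Nat.card_congr
      { toFun := fun v => ⟨v.1 - v₀, (hmemA' _).2 ⟨sub_mem v.2.1 hv₀, ?_⟩⟩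
        invFun := fun v => ⟨v.1 + v₀, add_mem ((hmemA' _).1 v.2).1 hv₀, ?_⟩
        left_inv := fun v => by simp
        right_inv := fun v => by simp }
    · rw [map_sub, v.2.2, hev₀, sub_self]
    · rw [map_add, ((hmemA' _).1 v.2).2, hev₀, zero_add]
  -- S is a coset of A' that is invariant under translation by multiples of e, since e is singular
  -- and lies in A.
  have hcount := ncard_singular_mul_card (totallySingular_span he0) (S := S)
    (fun v hv x hx => by
      obtain ⟨a, rfl⟩ := Submodule.mem_span_singleton.1 hx
      refine ⟨add_mem hv.1 (Submodule.smul_mem _ _ heA), ?_⟩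
      rw [map_add, hv.2, map_smul, F.form_self he0, smul_zero, add_zero])
    (fun v hv => ⟨e, Submodule.mem_span_singleton_self e, fun h => one_ne_zero
      (hv.2.symm.trans (F.form_eq_zero_comm.1 h))⟩)
  have hnot : ∀ v ∈ S, v ∉ W := by
    intro v hv hvW
    have h0 := hopp.symm.eq_zero hvW hv.1.1
    have := hv.2
    rw [h0, map_zero] at this
    exact zero_ne_one this
  have hunique : ∀ v ∈ S, ∀ w ∈ W, ∀ a : K, w + a • v ∈ F.perp U → w = 0 := by
    intro v hv w hw a h
    refine hopp.symm.eq_zero hw ?_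
    simpa using sub_mem h (Submodule.smul_mem _ a hv.1.1)
  -- An extension W' meets `F.perp U` in a line, which has a unique generator with form e v = 1;
  -- conversely v gives back W' as W + ⟨v⟩.
  have hbij : {v | v ∈ S ∧ F.norm v = 0}.ncard = Nat.card {W' : Submodule K V // W ≤ W' ∧
      finrank K W' = finrank K W + 1 ∧ F.TotallySingular W' ∧ F.Opposite U' W'} := by
    rw [← Nat.card_coe_set_eq]
    refine Nat.card_eq_of_bijective (fun v => ⟨W ⊔ (K ∙ v.1), le_sup_left,
      Submodule.finrank_sup_span (hnot v v.2.1), hW.sup (totallySingular_span v.2.2)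
      ((Submodule.span_singleton_le_iff_mem _ _).2 v.2.1.1.2), ?_⟩) ⟨?_, ?_⟩
    · refine opposite_of_finrank_eq ?_ ?_
      · rw [Submodule.finrank_sup_span (hnot v v.2.1), hr, hrW]
      · intro x hx hx'
        obtain ⟨w, hw, y, hy, rfl⟩ := Submodule.mem_sup.1 hx
        obtain ⟨a, rfl⟩ := Submodule.mem_span_singleton.1 hy
        have hw0 := hunique v v.2.1 w hw a (F.perp_anti hUU' hx')
        subst hw0
        have h1 := F.mem_perp.1 hx' e heU'
        rw [zero_add, map_smul, v.2.1.2, smul_eq_mul, mul_one] at h1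
        rw [h1, zero_smul, add_zero]
    · rintro ⟨v, hv, hv0⟩ ⟨v', hv', hv0'⟩ h
      have h1 : W ⊔ (K ∙ v) = W ⊔ (K ∙ v') := congrArg Subtype.val h
      have h2 : v ∈ W ⊔ (K ∙ v') :=
        h1 ▸ Submodule.mem_sup_right (Submodule.mem_span_singleton_self v)
      obtain ⟨w, hw, y, hy, hwy⟩ := Submodule.mem_sup.1 h2
      obtain ⟨a, rfl⟩ := Submodule.mem_span_singleton.1 hy
      have hw0 := hunique v' hv' w hw a (hwy ▸ hv.1.1)
      have h3 := hv.2
      rw [← hwy, hw0, zero_add, map_smul, hv'.2, smul_eq_mul, mul_one] at h3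
      refine Subtype.ext ?_
      change v = v'
      rw [← hwy, hw0, h3, one_smul, zero_add]
    · rintro ⟨W', hWW', hrW', hW', hopp'⟩
      obtain ⟨v, hv, hvU, hvW⟩ := line W' U W hcU
        (by rw [Module.natCard_eq_pow_finrank_of_field K W', hrW', hrW])
        (fun x hx hx' => hopp.eq_zero hx (F.perp_anti hWW' hx')) hopp.symm
      have hev : F.form e v ≠ 0 := by
        intro h0
        refine hvW ?_
        have : v ∈ F.perp U' := by
          rw [← hspan, perp_sup]
          exact ⟨hvU, F.mem_perp_span.2 h0⟩
        rw [hopp'.symm.eq_zero hv this]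
        exact W.zero_mem
      have hv' : (F.form e v)⁻¹ • v ∈ W' := Submodule.smul_mem _ _ hv
      have hvS : (F.form e v)⁻¹ • v ∈ S :=
        ⟨⟨Submodule.smul_mem _ _ hvU, F.perp_anti hWW' (hW'.le_perp hv')⟩, by
          rw [map_smul, smul_eq_mul, inv_mul_cancel₀ hev]⟩
      exact ⟨⟨_, hvS, hW'.norm_eq_zero hv'⟩, Subtype.ext
        (Submodule.sup_span_eq_of_finrank_eq hWW' hrW' hv' (hnot _ hvS))⟩
  rw [← hbij, ← hcA', ← hcS, show 2 * finrank K U + 2 = 1 + (finrank K U + (finrank K U + 1)) by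
    ring, pow_add, pow_add, pow_one, ← mul_assoc, hcount]
  ring

/-- An initial segment of an opposite flag is a shorter one with its last member. -/
def partialOppositeSuccEquiv (c : F.MaxFlag n) (k : ℕ) :
    PartialOpposite c (k + 1) ≃ {p : PartialOpposite c k × Submodule K V //
      p.1.1 (Fin.last k) ≤ p.2 ∧ finrank K p.2 = finrank K (p.1.1 (Fin.last k)) + 1 ∧
        F.TotallySingular p.2 ∧ F.Opposite (c.chain (k + 1)) p.2} where
  toFun d := ⟨⟨⟨fun i => d.1 i.castSucc, fun i => d.2.1 i.castSucc, fun i => d.2.2.1 i.castSucc,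
      fun i => d.2.2.2.1 _, fun i => d.2.2.2.2 i.castSucc⟩,
      d.1 (Fin.last (k + 1))⟩, d.2.1 (Fin.last k), by
      rw [d.2.2.1, d.2.2.1]; simp, d.2.2.2.1 _, d.2.2.2.2 (Fin.last (k + 1))⟩
  invFun p := ⟨Fin.snoc (α := fun _ => Submodule K V) p.1.1.1 p.1.2, by
    obtain ⟨⟨⟨d, h1, h2, h3, h4⟩, W⟩, g1, g2, g3, g4⟩ := p
    refine ⟨fun i => ?_, fun i => ?_, fun i => ?_, fun i => ?_⟩
    · refine Fin.lastCases ?_ (fun i => ?_) i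
      · rw [Fin.succ_last, Fin.snoc_last, Fin.snoc_castSucc]
        exact g1
      · rw [← Fin.castSucc_succ, Fin.snoc_castSucc, Fin.snoc_castSucc]
        exact h1 i
    · refine Fin.lastCases ?_ (fun i => ?_) i
      · rw [Fin.snoc_last, g2, h2]
        simp
      · rw [Fin.snoc_castSucc]
        exact h2 i
    · refine Fin.lastCases ?_ (fun i => ?_) i
      · rw [Fin.snoc_last]
        exact g3
      · rw [Fin.snoc_castSucc]
        exact h3 i
    · refine Fin.lastCases ?_ (fun i => ?_) i
      · rw [Fin.snoc_last]
        exact g4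
      · rw [Fin.snoc_castSucc]
        exact h4 i⟩
  left_inv d := Subtype.ext (Fin.snoc_init_self d.1)
  right_inv p := Subtype.ext (Prod.ext
    (Subtype.ext (Fin.init_snoc (α := fun _ => Submodule K V) p.1.2 p.1.1.1))
    (Fin.snoc_last (α := fun _ => Submodule K V) p.1.2 p.1.1.1))

instance (c : F.MaxFlag n) (k : ℕ) : Finite (PartialOpposite c k) := by
  have : Finite V := Module.finite_of_finite K
  have : Finite (Submodule K V) :=
    Finite.of_injective (fun U : Submodule K V => (U : Set V)) SetLike.coe_injective
  exact Subtype.finite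

/-- The number of extensions depends only on the length of the segment, so the total is a product;
the exponents 2l + 2 for l < k add up to k(k + 1). -/
theorem card_partialOpposite (c : F.MaxFlag n) (k : ℕ) (hk : k ≤ n) :
    Nat.card (PartialOpposite c k) * Nat.card K ^ (k * (k + 1))
      = (Nat.card V * Nat.card F.tr.ker) ^ k := by
  induction k with
  | zero => simp [card_partialOpposite_zero]
  | succ k ih =>
    have := Fintype.ofFinite (PartialOpposite c k)
    have : Finite V := Module.finite_of_finite K
    have : Finite (Submodule K V) :=
      Finite.of_injective (fun U : Submodule K V => (U : Set V)) SetLike.coe_injective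
    have h1 : Nat.card (PartialOpposite c (k + 1)) * Nat.card K ^ (2 * k + 2)
        = Nat.card (PartialOpposite c k) * (Nat.card V * Nat.card F.tr.ker) := by
      rw [Nat.card_congr ((partialOppositeSuccEquiv c k).trans
        (Equiv.subtypeProdEquivSigmaSubtype fun (d : PartialOpposite c k) (W' : Submodule K V) =>
          d.1 (Fin.last k) ≤ W' ∧ finrank K W' = finrank K (d.1 (Fin.last k)) + 1 ∧
            F.TotallySingular W' ∧ F.Opposite (c.chain (k + 1)) W')), Nat.card_sigma, Finset.sum_mul,
        Finset.sum_congr rfl fun (d : PartialOpposite c k) _ => ?_, Finset.sum_const,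
        smul_eq_mul, Finset.card_univ, ← Nat.card_eq_fintype_card]
      have e1 : finrank K (c.chain k) = k := c.finrank_chain (by omega)
      have e2 : finrank K (d.1 (Fin.last k)) = k := d.2.2.1 (Fin.last k)
      have := card_opposite_extensions (c.chain_mono (Nat.le_succ k))
        (c.totallySingular_chain hk) (by rw [c.finrank_chain hk, e1]) (d.2.2.2.1 (Fin.last k))
        (e2.trans e1.symm) (d.2.2.2.2 (Fin.last k))
      rw [e1] at this
      exact this
    rw [pow_succ, ← ih (by omega),
      show (k + 1) * (k + 1 + 1) = (2 * k + 2) + k * (k + 1) by ring, pow_add, ← mul_assoc, h1]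
    ring

/-- The degree of the opposition graph. -/
theorem MaxFlag.card_adj (hn : 0 < n) (c : F.MaxFlag n) :
    Nat.card {d : F.MaxFlag n // (F.oppositionGraph n).Adj c d} * Nat.card K ^ (n * (n + 1))
      = (Nat.card V * Nat.card F.tr.ker) ^ n := by
  rw [← card_partialOpposite c n le_rfl]
  congr 1
  refine Nat.card_congr
    { toFun := fun d => ⟨d.1.space, fun i => d.1.mono (Fin.castSucc_le_succ i), d.1.rank_eq,
        d.1.singular, fun i => ?_⟩
      invFun := fun d => ⟨⟨d.1, Fin.monotone_iff_le_succ.2 d.2.1, d.2.2.1, d.2.2.2.1⟩, ?_⟩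
      left_inv := fun d => rfl
      right_inv := fun d => rfl }
  · rw [← space_eq_chain]
    exact d.2.2 i
  · rw [adj_iff hn]
    intro k hk
    rw [MaxFlag.chain_of_le (c := ⟨d.1, _, _, _⟩) hk]
    exact d.2.2.2.2 ⟨k, by omega⟩

end OppositeFlags

end PolarForm

/-! ### The arithmetic in q and w. -/

/-- The number of singular vectors in the intersection of the `i`-th and the `k`-th member of the
chains of two opposite maximal flags, in terms of `q` and of `w = q ^ (e - 1)`. -/
noncomputable def interCount (q w : ℝ) (n i k : ℕ) : ℝ :=
  if i ≤ n ∨ k ≤ n then q ^ (i + k - 2 * n)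
  else q ^ (max i k - n) * (1 + (q ^ (min i k - n) - 1) * w)

/-- The number of singular vectors of types `i` and `k` for two opposite maximal flags. -/
noncomputable def typeCount (q w : ℝ) (n i k : ℕ) : ℝ :=
  interCount q w n i k - interCount q w n (i - 1) k - interCount q w n i (k - 1)
    + interCount q w n (i - 1) (k - 1)

/-- The entries of the quotient matrix, up to a factor, in terms of `q` and `w = q ^ (e - 1)`. -/
noncomputable def quotientEntry (q w : ℝ) (n i j : ℕ) : ℝ :=
  if i + j < 2 * n + 1 then 0
  else if j ≤ n then (q - 1 + if i + j = 2 * n + 1 then 1 else 0) * q ^ j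
  else (q - 1 + if i + j = 2 * n + 1 then 1 else 0) * (q ^ j * w)
    + (if i = j then 1 else 0) * q ^ n * (q * w - q)

theorem interCount_comm (q w : ℝ) (n i k : ℕ) : interCount q w n i k = interCount q w n k i := by
  simp only [interCount, or_comm, add_comm, max_comm, min_comm]

theorem interCount_of_le_left {q w : ℝ} {n i k : ℕ} (h : i ≤ n) :
    interCount q w n i k = q ^ (i + k - 2 * n) := if_pos (Or.inl h)

theorem interCount_of_le_right {q w : ℝ} {n i k : ℕ} (h : k ≤ n) :
    interCount q w n i k = q ^ (i + k - 2 * n) := if_pos (Or.inr h)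

theorem interCount_add_add (q w : ℝ) (n : ℕ) {a b : ℕ} (hab : a ≤ b) :
    interCount q w n (n + a) (n + b) = q ^ b * (1 + (q ^ a - 1) * w) := by
  rcases Nat.eq_zero_or_pos a with rfl | ha
  · rw [interCount_of_le_left (by omega), show n + 0 + (n + b) - 2 * n = b by omega]
    simp
  · rw [interCount, if_neg (by omega), max_eq_right (by omega), min_eq_left (by omega)]
    simp

theorem interCount_add_add' (q w : ℝ) (n : ℕ) {a b : ℕ} (hab : b ≤ a) :
    interCount q w n (n + a) (n + b) = q ^ a * (1 + (q ^ b - 1) * w) := by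
  rw [interCount_comm, interCount_add_add q w n hab]

/-- The number of singular vectors of type `i` for a maximal flag. -/
theorem interCount_sub_of_le {q w : ℝ} {n i : ℕ} (hi : 1 ≤ i) (hin : i ≤ n) :
    interCount q w n i (2 * n) - interCount q w n (i - 1) (2 * n) = (q - 1) * q ^ (i - 1) := by
  rw [interCount_of_le_left hin, interCount_of_le_left (by omega)]
  obtain ⟨a, rfl⟩ := Nat.exists_eq_add_of_le' hi
  rw [show a + 1 + 2 * n - 2 * n = a + 1 by omega, show a + 1 - 1 + 2 * n - 2 * n = a by omega]
  simp only [Nat.add_sub_cancel]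
  ring

theorem interCount_sub_of_lt {q w : ℝ} {n i : ℕ} (hin : n < i) (hi : i ≤ 2 * n) :
    interCount q w n i (2 * n) - interCount q w n (i - 1) (2 * n)
      = (q - 1) * q ^ (i - 1) * w := by
  obtain ⟨a, rfl⟩ := Nat.exists_eq_add_of_lt hin
  rw [show 2 * n = n + n by ring, show n + a + 1 - 1 = n + a by omega, add_assoc,
    interCount_add_add q w n (by omega), interCount_add_add q w n (by omega)]
  ring

/-- The identity needed to solve the double count for the matrix entry: |level i ∩ level j| divided
by |level i|, up to the factor q ^ (2n + 1) * w. -/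
theorem typeCount_mul (q w : ℝ) {n i j : ℕ} (hi : 1 ≤ i) (hi' : i ≤ 2 * n) (hj : 1 ≤ j)
    (hj' : j ≤ 2 * n) :
    typeCount q w n i j * (q ^ (2 * n + 1) * w)
      = (interCount q w n i (2 * n) - interCount q w n (i - 1) (2 * n))
        * quotientEntry q w n i j := by
  rcases Nat.lt_or_ge (i + j) (2 * n + 1) with h | h
  · rw [quotientEntry, if_pos h, mul_zero, typeCount]
    have key : interCount q w n i j = 1 ∧ interCount q w n (i - 1) j = 1 ∧
        interCount q w n i (j - 1) = 1 ∧ interCount q w n (i - 1) (j - 1) = 1 := by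
      refine ⟨?_, ?_, ?_, ?_⟩ <;>
      · rw [interCount, if_pos (by omega)]
        convert pow_zero q
        omega
    rw [key.1, key.2.1, key.2.2.1, key.2.2.2]
    ring
  have half : (i ≤ n ∨ j ≤ n) → typeCount q w n i j * q ^ (2 * n + 1)
      = (q - 1) * (q - 1 + if i + j = 2 * n + 1 then 1 else 0) * q ^ (i - 1 + j) := by
    intro hij
    have key : typeCount q w n i j = q ^ (i + j - 2 * n) - q ^ (i - 1 + j - 2 * n)
        - q ^ (i + (j - 1) - 2 * n) + q ^ (i - 1 + (j - 1) - 2 * n) := by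
      rcases hij with h | h
      · rw [typeCount]
        repeat rw [interCount_of_le_left (by omega)]
      · rw [typeCount]
        repeat rw [interCount_of_le_right (by omega)]
    rw [key]
    obtain ⟨s, hs⟩ := Nat.exists_eq_add_of_le h
    rw [show i + j - 2 * n = s + 1 by omega, show i - 1 + j - 2 * n = s by omega,
      show i + (j - 1) - 2 * n = s by omega, show i - 1 + (j - 1) - 2 * n = s - 1 by omega,
      show i - 1 + j = 2 * n + s by omega]
    -- For i + j = 2n + 1 the last exponent is truncated, so that the second difference is q - 1 and
    -- not (q - 1)² / q. This is the origin of the delta on the antidiagonal.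
    rcases s with _ | s
    · rw [if_pos (by omega)]
      simp
      ring
    · rw [if_neg (by omega)]
      simp only [Nat.add_sub_cancel]
      ring
  rcases le_or_gt i n with hin | hin
  · rw [interCount_sub_of_le hi hin, quotientEntry, if_neg (by omega), if_neg (by omega),
      if_neg (show i ≠ j by omega), ← mul_assoc, half (Or.inl hin)]
    ring
  rw [interCount_sub_of_lt hin hi', quotientEntry, if_neg (by omega)]
  rcases le_or_gt j n with hjn | hjn
  · rw [if_pos hjn, ← mul_assoc, half (Or.inr hjn)]
    ring
  rw [if_neg (by omega), if_neg (by omega), typeCount]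
  obtain ⟨a, rfl⟩ := Nat.exists_eq_add_of_lt hin
  obtain ⟨b, rfl⟩ := Nat.exists_eq_add_of_lt hjn
  rw [show n + a + 1 - 1 = n + a by omega, show n + b + 1 - 1 = n + b by omega, add_assoc n a 1,
    add_assoc n b 1]
  -- Off the diagonal all four terms come from the same branch of max and min. On the diagonal both
  -- branches occur, which produces the summand with q * w - q.
  rcases lt_trichotomy a b with hab | rfl | hab
  · rw [if_neg (by omega)]
    repeat rw [interCount_add_add q w n (by omega)]
    ring
  · rw [if_pos rfl]
    rw [interCount_add_add q w n (le_refl (a + 1)), interCount_add_add q w n (Nat.le_add_right a 1),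
      interCount_add_add' q w n (Nat.le_add_right a 1), interCount_add_add q w n (le_refl a)]
    ring
  · rw [if_neg (by omega)]
    repeat rw [interCount_add_add' q w n (by omega)]
    ring

/-! ### The double count of vectors and opposite flags. -/

namespace PolarForm

section Entries

variable {K V : Type*} [Field K] [AddCommGroup V] [Module K V] {F : PolarForm K V} {n : ℕ}

/-- The singular vectors in the `i`-th but not in the previous member of the chain. -/
def MaxFlag.level (c : F.MaxFlag n) (i : ℕ) : Set V :=
  {v | (v ∈ c.chain i ∧ v ∉ c.chain (i - 1)) ∧ F.norm v = 0}

theorem opposite_map (g : F.isometryGroup) {U W : Submodule K V} (h : F.Opposite U W) :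
    F.Opposite (U.map (g.1 : V →ₗ[K] V)) (W.map (g.1 : V →ₗ[K] V)) := by
  have hg : Function.Injective (g.1 : V →ₗ[K] V) := g.1.injective
  constructor
  · rw [perp_map, ← Submodule.map_inf _ hg, h.1, Submodule.map_bot]
  · rw [perp_map, ← Submodule.map_inf _ hg, h.2, Submodule.map_bot]

theorem adj_smul_of_adj (g : F.isometryGroup) {c d : F.MaxFlag n}
    (h : (F.oppositionGraph n).Adj c d) : (F.oppositionGraph n).Adj (g • c) (g • d) :=
  ⟨fun h' => h.1 (smul_left_cancel g h'), fun i => opposite_map g (h.2 i)⟩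

theorem adj_smul_iff (g : F.isometryGroup) (c d : F.MaxFlag n) :
    (F.oppositionGraph n).Adj (g • c) (g • d) ↔ (F.oppositionGraph n).Adj c d := by
  refine ⟨fun h => ?_, adj_smul_of_adj g⟩
  have := adj_smul_of_adj g⁻¹ h
  rwa [inv_smul_smul, inv_smul_smul] at this

theorem MaxFlag.mem_level_iff [FiniteDimensional K V] (hn : 0 < n) (c : F.MaxFlag n) {i : ℕ}
    (hi : 1 ≤ i) {v : V} :
    v ∈ c.level i ↔ F.norm v = 0 ∧ v ≠ 0 ∧ c.type (K ∙ v) = i := by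
  by_cases hv : v = 0
  · subst hv
    simp [level]
  · have h0 : (K ∙ v) ≠ ⊥ := by rwa [ne_eq, Submodule.span_singleton_eq_bot]
    rw [c.type_eq_iff hn h0 hi, Submodule.span_singleton_le_iff_mem,
      Submodule.span_singleton_le_iff_mem, level, Set.mem_ofPred_eq]
    tauto

variable [Finite K] [FiniteDimensional K V]

theorem singCard_chain_inf_chain (hr : F.HasRank n) {c d : F.MaxFlag n}
    (h : ∀ k ≤ n, F.Opposite (c.chain k) (d.chain k)) {i k : ℕ} (hi : i ≤ 2 * n)
    (hk : k ≤ 2 * n) :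
    (F.singCard (c.chain i ⊓ d.chain k) : ℝ) = interCount (Nat.card K) (F.weight n) n i k := by
  have h' : ∀ k ≤ n, F.Opposite (d.chain k) (c.chain k) := fun k hk => (h k hk).symm
  rcases le_or_gt i n with hin | hin
  · rw [interCount_of_le_left hin, singCard_chain_inf_chain_of_le h hin hk]
    push_cast
    rfl
  rcases le_or_gt k n with hkn | hkn
  · rw [interCount_of_le_right hkn, inf_comm, singCard_chain_inf_chain_of_le h' hkn hi, add_comm k]
    push_cast
    rfl
  obtain ⟨a, rfl⟩ := Nat.exists_eq_add_of_le hin.le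
  obtain ⟨b, rfl⟩ := Nat.exists_eq_add_of_le hkn.le
  rw [c.chain_of_lt hin, d.chain_of_lt hkn]
  rcases le_total a b with hab | hab
  · rw [singCard_perp_inf_perp hr h (by omega) (by omega), interCount_add_add _ _ _ hab,
      show n - (2 * n - (n + b)) = b by omega, show n - (2 * n - (n + a)) = a by omega]
  · rw [inf_comm, singCard_perp_inf_perp hr h' (by omega) (by omega),
      interCount_add_add' _ _ _ hab,
      show n - (2 * n - (n + b)) = b by omega, show n - (2 * n - (n + a)) = a by omega]

theorem ncard_level_inf (hr : F.HasRank n) {c d : F.MaxFlag n}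
    (h : ∀ k ≤ n, F.Opposite (c.chain k) (d.chain k)) {i k : ℕ} (hi : i ≤ 2 * n)
    (hk : k ≤ 2 * n) :
    ((c.level i ∩ d.chain k).ncard : ℝ) = interCount (Nat.card K) (F.weight n) n i k
      - interCount (Nat.card K) (F.weight n) n (i - 1) k := by
  have : Finite V := Module.finite_of_finite K
  have hsub : {v | v ∈ c.chain (i - 1) ⊓ d.chain k ∧ F.norm v = 0}
      ⊆ {v | v ∈ c.chain i ⊓ d.chain k ∧ F.norm v = 0} :=
    fun v hv => ⟨⟨c.chain_mono (Nat.sub_le i 1) hv.1.1, hv.1.2⟩, hv.2⟩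
  rw [← singCard_chain_inf_chain hr h hi hk, ← singCard_chain_inf_chain hr h (by omega) hk,
    singCard, singCard, ← Set.ncard_sdiff_add_ncard_of_subset hsub (Set.toFinite _)]
  push_cast
  rw [add_sub_cancel_right]
  congr 2
  ext v
  simp only [MaxFlag.level, Set.mem_inter_iff, Set.mem_ofPred_eq, Set.mem_sdiff, SetLike.mem_coe,
    Submodule.mem_inf]
  tauto

theorem ncard_level_inter_level (hr : F.HasRank n) {c d : F.MaxFlag n}
    (h : ∀ k ≤ n, F.Opposite (c.chain k) (d.chain k)) {i j : ℕ} (hi : i ≤ 2 * n)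
    (hj : j ≤ 2 * n) :
    ((c.level i ∩ d.level j).ncard : ℝ) = typeCount (Nat.card K) (F.weight n) n i j := by
  have : Finite V := Module.finite_of_finite K
  have hsub : c.level i ∩ d.chain (j - 1) ⊆ c.level i ∩ d.chain j :=
    Set.inter_subset_inter_right _ (d.chain_mono (Nat.sub_le j 1))
  have h1 := Set.ncard_sdiff_add_ncard_of_subset hsub (Set.toFinite _)
  have h2 : (c.level i ∩ d.chain j) \ (c.level i ∩ d.chain (j - 1)) = c.level i ∩ d.level j := by
    ext v
    simp only [MaxFlag.level, Set.mem_inter_iff, Set.mem_ofPred_eq, Set.mem_sdiff, SetLike.mem_coe]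
    tauto
  rw [h2] at h1
  have h3 : ((c.level i ∩ d.level j).ncard : ℝ) + (c.level i ∩ d.chain (j - 1)).ncard
      = (c.level i ∩ d.chain j).ncard := by exact_mod_cast h1
  rw [ncard_level_inf hr h hi hj, ncard_level_inf hr h hi (by omega)] at h3
  rw [typeCount]
  linarith

theorem MaxFlag.exists_adj (hn : 0 < n) (c : F.MaxFlag n) :
    ∃ d, (F.oppositionGraph n).Adj c d := by
  have : Finite V := Module.finite_of_finite K
  have h := c.card_adj hn
  have h1 : 0 < (Nat.card V * Nat.card F.tr.ker) ^ n :=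
    pow_pos (Nat.mul_pos Nat.card_pos Nat.card_pos) n
  rw [← h] at h1
  obtain ⟨⟨d, hd⟩⟩ := (Nat.card_pos_iff.1 (Nat.pos_of_mul_pos_right h1)).1
  exact ⟨d, hd⟩

/-- The last member of the chain of an opposite flag is V, so the count for pairs of opposite flags
also counts a single level. -/
theorem MaxFlag.ncard_level (hn : 0 < n) (hr : F.HasRank n) (c : F.MaxFlag n) {i : ℕ}
    (hi : i ≤ 2 * n) : ((c.level i).ncard : ℝ)
      = interCount (Nat.card K) (F.weight n) n i (2 * n)
        - interCount (Nat.card K) (F.weight n) n (i - 1) (2 * n) := by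
  obtain ⟨d, hd⟩ := c.exists_adj hn
  rw [← ncard_level_inf hr ((adj_iff hn c d).1 hd) hi le_rfl, d.chain_two_mul hn]
  simp

theorem weight_pos : 0 < F.weight n := by
  have : Finite V := Module.finite_of_finite K
  have h1 : 0 < Nat.card K := Nat.card_pos
  have h2 : 0 < Nat.card V := Nat.card_pos
  have h3 : 0 < Nat.card F.tr.ker := Nat.card_pos
  rw [weight]
  positivity

theorem MaxFlag.ncard_level_pos (hn : 0 < n) (hr : F.HasRank n) (c : F.MaxFlag n) {i : ℕ}
    (hi : 1 ≤ i) (hi' : i ≤ 2 * n) : (0 : ℝ) < (c.level i).ncard := by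
  have hq : (1 : ℝ) < Nat.card K := by exact_mod_cast Finite.one_lt_card (α := K)
  have hq1 : (0 : ℝ) < Nat.card K - 1 := by linarith
  have hq0 : (0 : ℝ) < Nat.card K := by linarith
  have hw : 0 < F.weight n := weight_pos
  rw [c.ncard_level hn hr hi']
  rcases le_or_gt i n with h | h
  · rw [interCount_sub_of_le hi h]
    positivity
  · rw [interCount_sub_of_lt h hi']
    positivity

theorem MaxFlag.card_adj_real (hn : 0 < n) (c : F.MaxFlag n) :
    (Nat.card {d : F.MaxFlag n // (F.oppositionGraph n).Adj c d} : ℝ)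
      = (Nat.card K : ℝ) ^ (n * n) * F.weight n ^ n := by
  have h : (Nat.card {d : F.MaxFlag n // (F.oppositionGraph n).Adj c d} : ℝ)
      * (Nat.card K : ℝ) ^ (n * (n + 1)) = (Nat.card V * Nat.card F.tr.ker) ^ n := by
    exact_mod_cast c.card_adj hn
  have hq : (Nat.card K : ℝ) ≠ 0 := by exact_mod_cast Nat.card_pos.ne'
  have hw : (Nat.card V : ℝ) * Nat.card F.tr.ker
      = F.weight n * (Nat.card K : ℝ) ^ (2 * n + 1) := by
    rw [weight]
    field_simp
  rw [hw] at h
  refine mul_right_cancel₀ (pow_ne_zero (n * (n + 1)) hq) ?_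
  rw [h]
  ring

/-- The number of maximal flags opposite to `c` that have type `j` with respect to a point depends
only on the type of `c`. -/
theorem MaxFlag.card_adj_type_mul (hn : 0 < n) (hr : F.HasRank n) (c : F.MaxFlag n)
    {X : Submodule K V} (hX : F.IsPoint X) {j : ℕ} (hj : 1 ≤ j) (hj' : j ≤ 2 * n) :
    (Nat.card {d : F.MaxFlag n // (F.oppositionGraph n).Adj c d ∧ d.type X = j} : ℝ)
        * (c.level (c.type X)).ncard
      = (Nat.card K : ℝ) ^ (n * n) * F.weight n ^ n
        * typeCount (Nat.card K) (F.weight n) n (c.type X) j := by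
  classical
  have : Finite V := Module.finite_of_finite K
  obtain ⟨hi, hi'⟩ := Finset.mem_Icc.1 (c.type_mem_Icc hn X)
  have := Fintype.ofFinite (c.level (c.type X))
  have := Fintype.ofFinite {d : F.MaxFlag n // (F.oppositionGraph n).Adj c d}
  set D := {d : F.MaxFlag n // (F.oppositionGraph n).Adj c d} with hD
  -- The same pairs are counted by the flag here and by the vector in `e2`. Vectors in place of
  -- points multiply both sides by q - 1.
  have e1 : (Nat.card {p : D × c.level (c.type X) // p.2.1 ∈ p.1.1.level j} : ℝ)
      = (Nat.card K : ℝ) ^ (n * n) * F.weight n ^ n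
        * typeCount (Nat.card K) (F.weight n) n (c.type X) j := by
    rw [Nat.card_congr (Equiv.subtypeProdEquivSigmaSubtype
      fun (d : D) (v : c.level (c.type X)) => v.1 ∈ d.1.level j), Nat.card_sigma]
    push_cast
    rw [← c.card_adj_real hn, Finset.sum_congr rfl fun (d : D) _ => ?_, Finset.sum_const,
      nsmul_eq_mul, Finset.card_univ, ← Nat.card_eq_fintype_card]
    rw [← ncard_level_inter_level hr ((adj_iff hn c d.1).1 d.2) hi' hj', ← Nat.card_coe_set_eq]
    exact congrArg _ (Nat.card_congr (Equiv.subtypeSubtypeEquivSubtypeInter _ _))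
  have e2 : (Nat.card {p : c.level (c.type X) × D // p.1.1 ∈ p.2.1.level j} : ℝ)
      = Nat.card {d : F.MaxFlag n // (F.oppositionGraph n).Adj c d ∧ d.type X = j}
        * (c.level (c.type X)).ncard := by
    rw [Nat.card_congr (Equiv.subtypeProdEquivSigmaSubtype
      fun (v : c.level (c.type X)) (d : D) => v.1 ∈ d.1.level j), Nat.card_sigma]
    push_cast
    rw [Finset.sum_congr rfl fun (v : c.level (c.type X)) _ => ?_, Finset.sum_const,
      nsmul_eq_mul, Finset.card_univ, ← Nat.card_eq_fintype_card, Nat.card_coe_set_eq, mul_comm]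
    obtain ⟨h0, h0', hv⟩ := (c.mem_level_iff hn hi).1 v.2
    -- An isometry that fixes c and carries X to ⟨v⟩ permutes the neighbours of c and turns types
    -- with respect to X into types with respect to ⟨v⟩.
    obtain ⟨g, hgc, hgX⟩ := c.exists_smul_eq_self_map_eq hn hr hX (isPoint_span h0 h0') hv.symm
    rw [Nat.card_congr (Equiv.subtypeSubtypeEquivSubtypeInter
      (fun d => (F.oppositionGraph n).Adj c d) fun d => v.1 ∈ d.level j)]
    refine congrArg _ (Nat.card_congr ((MulAction.toPerm g).subtypeEquiv fun d => ?_)).symm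
    rw [MulAction.toPerm_apply, mem_level_iff hn _ hj, ← hgX, type_smul]
    nth_rewrite 2 [← hgc]
    rw [adj_smul_iff]
    tauto
  rw [← e2, ← e1]
  exact congrArg _ (Nat.card_congr ((Equiv.prodComm _ _).subtypeEquiv fun _ => Iff.rfl))

theorem MaxFlag.card_adj_type (hn : 0 < n) (hr : F.HasRank n) (c : F.MaxFlag n)
    {X : Submodule K V} (hX : F.IsPoint X) {j : ℕ} (hj : 1 ≤ j) (hj' : j ≤ 2 * n) :
    (Nat.card {d : F.MaxFlag n // (F.oppositionGraph n).Adj c d ∧ d.type X = j} : ℝ)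
        * ((Nat.card K : ℝ) ^ (2 * n + 1) * F.weight n)
      = (Nat.card K : ℝ) ^ (n * n) * F.weight n ^ n
        * quotientEntry (Nat.card K) (F.weight n) n (c.type X) j := by
  obtain ⟨hi, hi'⟩ := Finset.mem_Icc.1 (c.type_mem_Icc hn X)
  refine mul_right_cancel₀ (c.ncard_level_pos hn hr hi hi').ne' ?_
  have h1 := c.card_adj_type_mul hn hr hX hj hj'
  have h2 := typeCount_mul (Nat.card K) (F.weight n) hi hi' hj hj'
  rw [← c.ncard_level hn hr hi'] at h2
  linear_combination ((Nat.card K : ℝ) ^ (2 * n + 1) * F.weight n) * h1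
    + ((Nat.card K : ℝ) ^ (n * n) * F.weight n ^ n) * h2

end Entries

end PolarForm

/-! ### Existence of all types. -/

namespace PolarForm

section Existence

variable {K V : Type*} [Field K] [AddCommGroup V] [Module K V] {F : PolarForm K V} {n : ℕ}

theorem HasRank.nonempty_maxFlag [FiniteDimensional K V] (hr : F.HasRank n) :
    Nonempty (F.MaxFlag n) := by
  obtain ⟨U, hU, hUn⟩ := hr.1
  let b := Module.finBasisOfFinrankEq K U hUn
  have hle : ∀ i : Fin (n + 1), (i : ℕ) ≤ n := fun i => Nat.lt_succ_iff.1 i.2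
  have hli : LinearIndependent K fun j => (b j : V) :=
    b.linearIndependent.map' U.subtype U.ker_subtype
  refine ⟨⟨fun i => Submodule.span K (Set.range fun j : Fin i => (b (Fin.castLE (hle i) j) : V)),
    fun i i' hii => Submodule.span_mono ?_, fun i => ?_, fun i => hU.mono ?_⟩⟩
  · rintro _ ⟨j, rfl⟩
    exact ⟨Fin.castLE hii j, rfl⟩
  · have := finrank_span_eq_card (hli.comp (Fin.castLE (hle i)) (Fin.castLE_injective _))
    rwa [Fintype.card_fin] at this
  · rw [Submodule.span_le]
    rintro _ ⟨j, rfl⟩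
    exact (b _).2

/-- Every level of any one flag contains a singular vector v ≠ 0, and an isometry moves ⟨v⟩ to X. -/
theorem MaxFlag.exists_type_eq [Finite K] [FiniteDimensional K V] (hn : 0 < n)
    (hr : F.HasRank n) {X : Submodule K V} (hX : F.IsPoint X) {i : ℕ} (hi : 1 ≤ i)
    (hi' : i ≤ 2 * n) : ∃ c : F.MaxFlag n, c.type X = i := by
  obtain ⟨c⟩ := hr.nonempty_maxFlag
  have hpos := c.ncard_level_pos hn hr hi hi'
  obtain ⟨v, hv⟩ := Set.nonempty_of_ncard_ne_zero (Nat.cast_pos.1 hpos).ne'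
  obtain ⟨h0, hv0, ht⟩ := (c.mem_level_iff hn hi).1 hv
  obtain ⟨x, hx0, hx, rfl⟩ := hX.exists_eq_span
  obtain ⟨g, hg, -⟩ := exists_isometry_fix (F := F) (totallySingular_bot (F := F)) h0 hx
    (by rw [perp_bot]; trivial) (by rw [perp_bot]; trivial)
    (by rwa [Submodule.mem_bot]) (by rwa [Submodule.mem_bot])
  refine ⟨g • c, ?_⟩
  rw [← ht, ← c.type_smul g, Submodule.map_span, Set.image_singleton, LinearEquiv.coe_coe, hg]

end Existence

/-! ### The weight in terms of e. -/

section Weight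

/-- The image of the trace is the fixed field. Multiplication by b - σ b, which σ negates, maps it
bijectively onto the kernel, so both have order √q. -/
theorem card_trace_ker_mul_self {K : Type*} [Field K] (σ : K →+* K)
    (invol : ∀ a, σ (σ a) = a) (nontriv : σ ≠ RingHom.id K) :
    Nat.card (AddMonoidHom.id K + σ.toAddMonoidHom).ker
      * Nat.card (AddMonoidHom.id K + σ.toAddMonoidHom).ker = Nat.card K := by
  set T := AddMonoidHom.id K + σ.toAddMonoidHom with hT
  have hTa : ∀ a, T a = a + σ a := fun a => rfl
  obtain ⟨b, hb⟩ : ∃ b, b - σ b ≠ 0 := by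
    by_contra! H
    exact nontriv (RingHom.ext fun a => (sub_eq_zero.1 (H a)).symm)
  obtain ⟨c, hc⟩ : ∃ c, c + σ c ≠ 0 := by
    by_contra! H
    refine nontriv (RingHom.ext fun a => ?_)
    have h1 := H 1
    have h2 := H a
    rw [map_one] at h1
    simp only [RingHom.id_apply]
    linear_combination h2 - a * h1
  have hσb : σ (b - σ b) = -(b - σ b) := by rw [map_sub, invol]; ring
  have hσc : σ (c + σ c) = c + σ c := by rw [map_add, invol]; ring
  have hrange : ∀ y, y ∈ T.range ↔ σ y = y := by
    intro y
    constructor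
    · rintro ⟨x, rfl⟩
      rw [hTa, map_add, invol, add_comm]
    · intro hy
      refine ⟨y * c * (c + σ c)⁻¹, ?_⟩
      rw [hTa, map_mul, map_mul, map_inv₀, hσc, hy]
      field_simp
  have hcard : Nat.card T.ker = Nat.card T.range := by
    refine Nat.card_congr
      { toFun := fun x => ⟨x.1 * (b - σ b)⁻¹, (hrange _).2 ?_⟩
        invFun := fun y => ⟨y.1 * (b - σ b), ?_⟩
        left_inv := fun x => Subtype.ext (inv_mul_cancel_right₀ hb x.1)
        right_inv := fun y => Subtype.ext (mul_inv_cancel_right₀ hb y.1) }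
    · have hx : x.1 + σ x.1 = 0 := x.2
      rw [map_mul, map_inv₀, hσb, eq_neg_of_add_eq_zero_right hx, inv_neg, neg_mul_neg]
    · rw [AddMonoidHom.mem_ker, hTa, map_mul, hσb, (hrange _).1 y.2]
      ring
  nth_rewrite 2 [hcard]
  rw [← AddSubgroup.index_ker, AddSubgroup.card_mul_index]

variable {K V : Type*} [Field K] [Finite K] [AddCommGroup V] [Module K V]

/-- The kernel of the trace has q ^ k elements with k = 1 (symplectic), 1/2 (Hermitian) or 0
(quadratic), and dim V + k = 2n + e in every case. -/
theorem IsPS.weight_eq [FiniteDimensional K V] {F : PolarForm K V} {n : ℕ} {e : ℝ}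
    (hF : F.IsPS n e) : F.weight n = (Nat.card K : ℝ) ^ (e - 1) := by
  have hq : (0 : ℝ) < Nat.card K := by exact_mod_cast Nat.card_pos
  suffices (Nat.card V : ℝ) * Nat.card F.tr.ker = (Nat.card K : ℝ) ^ (2 * n + e) by
    rw [weight, this, ← Real.rpow_natCast, ← Real.rpow_sub hq]
    congr 1
    push_cast
    ring
  have hV : (Nat.card V : ℝ) = (Nat.card K : ℝ) ^ (finrank K V : ℝ) := by
    rw [Real.rpow_natCast]
    exact_mod_cast Module.natCard_eq_pow_finrank_of_field K V
  suffices ∃ k : ℝ, (Nat.card F.tr.ker : ℝ) = (Nat.card K : ℝ) ^ k ∧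
      (finrank K V : ℝ) + k = 2 * n + e by
    obtain ⟨k, h1, h2⟩ := this
    rw [hV, h1, ← Real.rpow_add hq, h2]
  cases F with
  | symplectic B _ _ =>
    obtain ⟨-, hd, rfl⟩ := hF
    refine ⟨1, ?_, by rw [hd]; push_cast; ring⟩
    rw [Real.rpow_one]
    congr 1
    exact Nat.card_congr (Equiv.subtypeUnivEquiv fun x => rfl)
  | hermitian σ i hσ h _ _ =>
    refine ⟨1 / 2, ?_, ?_⟩
    · rw [← Real.sqrt_eq_rpow, eq_comm, Real.sqrt_eq_iff_mul_self_eq hq.le (Nat.cast_nonneg _)]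
      exact_mod_cast (card_trace_ker_mul_self σ i hσ).symm
    · obtain ⟨-, ⟨hd, rfl⟩ | ⟨hd, rfl⟩⟩ := hF <;> rw [hd] <;> push_cast <;> ring
  | quadratic Q _ =>
    refine ⟨0, ?_, ?_⟩
    · rw [Real.rpow_zero]
      have : Nat.card (AddMonoidHom.id K).ker = 1 := by
        rw [Nat.card_eq_one_iff_unique]
        exact ⟨⟨fun x y => Subtype.ext ((AddMonoidHom.mem_ker.1 x.2).trans
          (AddMonoidHom.mem_ker.1 y.2).symm)⟩, ⟨0⟩⟩
      exact_mod_cast this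
    · obtain ⟨-, ⟨hd, rfl⟩ | ⟨hd, rfl⟩ | ⟨hd, rfl⟩⟩ := hF <;> rw [hd] <;> push_cast <;> ring

end Weight

/-! ### Orbits and the quotient matrix. -/

section Quotient

variable {K V : Type*} [Field K] [AddCommGroup V] [Module K V] {F : PolarForm K V} {n : ℕ}

theorem MaxFlag.type_eq_of_mem_stabilizer {X : Submodule K V} {g : F.isometryGroup}
    (hg : g ∈ F.stabilizer X) (c : F.MaxFlag n) : (g • c).type X = c.type X := by
  have hg' : X.map (g.1 : V →ₗ[K] V) = X := hg
  nth_rewrite 1 [← hg']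
  exact c.type_smul g X

variable [Finite K] [FiniteDimensional K V]

theorem range_flagsOfType (hn : 0 < n) (hr : F.HasRank n) {X : Submodule K V}
    (hX : F.IsPoint X) :
    (Set.range fun i : Finset.Icc 1 (2 * n) => F.flagsOfType n X i)
      = Set.range fun c : F.MaxFlag n => MulAction.orbit (F.stabilizer X) c := by
  have key : ∀ c : F.MaxFlag n,
      F.flagsOfType n X (c.type X) = MulAction.orbit (F.stabilizer X) c := by
    intro c
    ext d
    constructor
    · intro hd
      obtain ⟨g, hg, rfl⟩ := c.exists_smul_eq_of_type_eq hn hr hX (Eq.symm hd)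
      exact ⟨⟨g, hg⟩, rfl⟩
    · rintro ⟨⟨g, hg⟩, rfl⟩
      exact c.type_eq_of_mem_stabilizer hg
  ext S
  constructor
  · rintro ⟨⟨i, hi⟩, rfl⟩
    obtain ⟨hi1, hi2⟩ := Finset.mem_Icc.1 hi
    obtain ⟨c, rfl⟩ := MaxFlag.exists_type_eq hn hr hX hi1 hi2
    exact ⟨c, (key c).symm⟩
  · rintro ⟨c, rfl⟩
    exact ⟨⟨c.type X, c.type_mem_Icc hn X⟩, key c⟩

theorem flagsOfType_injective (hn : 0 < n) (hr : F.HasRank n) {X : Submodule K V}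
    (hX : F.IsPoint X) :
    Function.Injective fun i : Finset.Icc 1 (2 * n) => F.flagsOfType n X i := by
  rintro ⟨i, hi⟩ ⟨j, hj⟩ h
  obtain ⟨hi1, hi2⟩ := Finset.mem_Icc.1 hi
  obtain ⟨c, hc⟩ := MaxFlag.exists_type_eq hn hr hX hi1 hi2
  have h1 : c ∈ F.flagsOfType n X i := hc
  have h2 : c ∈ F.flagsOfType n X j := (show F.flagsOfType n X i = F.flagsOfType n X j from h) ▸ h1
  exact Subtype.ext (hc.symm.trans h2)

open Classical in
/-- The quotient matrix counts the neighbours of each type of a maximal flag. -/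
theorem isQuotientMatrix_iff (hn : 0 < n) (hr : F.HasRank n) {X : Submodule K V}
    (hX : F.IsPoint X) (Q : Matrix (Finset.Icc 1 (2 * n)) (Finset.Icc 1 (2 * n)) ℝ) :
    IsQuotientMatrix (F.oppositionGraph n) (F.stabilizer X)
        (fun i : Finset.Icc 1 (2 * n) => F.flagsOfType n X i) Q ↔
      ∀ (c : F.MaxFlag n) (j : Finset.Icc 1 (2 * n)),
        (Nat.card {d : F.MaxFlag n // (F.oppositionGraph n).Adj c d ∧ d.type X = j} : ℝ)
          = Q ⟨c.type X, c.type_mem_Icc hn X⟩ j := by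
  -- The instance with which `IsQuotientMatrix` forms the matrix product.
  let _ := Fintype.ofFinite (F.MaxFlag n)
  have hA : ∀ (c : F.MaxFlag n) (j : Finset.Icc 1 (2 * n)),
      ((F.oppositionGraph n).adjMatrix ℝ * characteristicMatrix
        (fun i : Finset.Icc 1 (2 * n) => F.flagsOfType n X i)) c j
        = Nat.card {d : F.MaxFlag n // (F.oppositionGraph n).Adj c d ∧ d.type X = j} := by
    intro c j
    rw [Matrix.mul_apply, Nat.card_eq_fintype_card, Fintype.card_subtype, Finset.card_filter]
    push_cast
    refine Finset.sum_congr rfl fun d _ => ?_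
    by_cases h1 : (F.oppositionGraph n).Adj c d <;> by_cases h2 : d.type X = j <;>
      simp [SimpleGraph.adjMatrix_apply, characteristicMatrix, flagsOfType, h1, h2]
  have hB : ∀ (c : F.MaxFlag n) (j : Finset.Icc 1 (2 * n)),
      (characteristicMatrix (fun i : Finset.Icc 1 (2 * n) => F.flagsOfType n X i) * Q) c j
        = Q ⟨c.type X, c.type_mem_Icc hn X⟩ j := by
    intro c j
    rw [Matrix.mul_apply, Finset.sum_eq_single ⟨c.type X, c.type_mem_Icc hn X⟩]
    · simp [characteristicMatrix, flagsOfType]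
    · intro i _ hi
      have : c.type X ≠ i := fun h => hi (Subtype.ext h.symm)
      simp [characteristicMatrix, flagsOfType, this]
    · simp
  constructor
  · intro h c j
    rw [← hA, ← hB]
    exact congrFun (congrFun h.eq c) j
  · intro h
    refine ⟨fun g _ c d => adj_smul_iff g c d, flagsOfType_injective hn hr hX,
      range_flagsOfType hn hr hX, ?_⟩
    ext c j
    exact (hA c j).trans ((h c j).trans (hB c j).symm)

end Quotient

end PolarForm

/-! ### The entries of the quotient matrix. -/

theorem mainTheorem5 {K V : Type*} [Field K] [Finite K] [AddCommGroup V] [Module K V]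
    [FiniteDimensional K V] (F : PolarForm K V) (n : ℕ) (hn : 2 ≤ n) (e q : ℝ)
    (hq : q = Nat.card K) (hF : F.IsPS n e) (X : Submodule K V) (hX : F.IsPoint X)
    (Q : Matrix (Finset.Icc 1 (2 * n)) (Finset.Icc 1 (2 * n)) ℝ) :
    IsQuotientMatrix (F.oppositionGraph n) (F.stabilizer X)
        (fun i : Finset.Icc 1 (2 * n) => F.flagsOfType n X i) Q ↔
      ∀ i j : Finset.Icc 1 (2 * n),
        Q i j / q ^ ((n : ℝ) * (n + e - 3) - e) =
          if (i : ℕ) + j < 2 * n + 1 then 0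
          else if (j : ℕ) ≤ n then
            (q - 1 + if (i : ℕ) + j = 2 * n + 1 then 1 else 0) * q ^ (j : ℕ)
          else
            (q - 1 + if (i : ℕ) + j = 2 * n + 1 then 1 else 0) * q ^ ((j : ℝ) + e - 1)
              + (if i = j then 1 else 0) * q ^ n * (q ^ e - q) := by
  have hn0 : 0 < n := by omega
  have hr := hF.1
  have hq0 : 0 < q := by
    rw [hq]
    exact_mod_cast Nat.card_pos
  have hw : F.weight n = q ^ (e - 1) := by rw [hq, hF.weight_eq]
  have hs : (0 : ℝ) < q ^ ((n : ℝ) * (n + e - 3) - e) := Real.rpow_pos_of_pos hq0 _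
  have hcount : ∀ (c : F.MaxFlag n) (j : Finset.Icc 1 (2 * n)),
      (Nat.card {d : F.MaxFlag n // (F.oppositionGraph n).Adj c d ∧ d.type X = j} : ℝ)
        = q ^ ((n : ℝ) * (n + e - 3) - e) * quotientEntry q (q ^ (e - 1)) n (c.type X) j := by
    intro c j
    obtain ⟨hj, hj'⟩ := Finset.mem_Icc.1 j.2
    have h := c.card_adj_type hn0 hr hX hj hj'
    rw [← hq, hw] at h
    have h0 : q ^ (2 * n + 1) * q ^ (e - 1) ≠ 0 := by positivity
    refine mul_right_cancel₀ h0 (h.trans ?_)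
    -- The degree is the claimed scale factor times q ^ (2n + 1) * w, because n² + n(e - 1) = (n(n +
    -- e - 3) - e) + (2n + 1) + (e - 1).
    have h1 : q ^ (n * n) * (q ^ (e - 1)) ^ n
        = q ^ ((n : ℝ) * (n + e - 3) - e) * (q ^ (2 * n + 1) * q ^ (e - 1)) := by
      rw [← Real.rpow_natCast, ← Real.rpow_natCast, ← Real.rpow_natCast, ← Real.rpow_mul hq0.le,
        ← Real.rpow_add hq0, ← Real.rpow_add hq0, ← Real.rpow_add hq0]
      congr 1
      push_cast
      ring
    rw [h1]
    ring
  have hentry : ∀ i j : Finset.Icc 1 (2 * n), (quotientEntry q (q ^ (e - 1)) n i j : ℝ) =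
      if (i : ℕ) + j < 2 * n + 1 then 0
      else if (j : ℕ) ≤ n then
        (q - 1 + if (i : ℕ) + j = 2 * n + 1 then 1 else 0) * q ^ (j : ℕ)
      else
        (q - 1 + if (i : ℕ) + j = 2 * n + 1 then 1 else 0) * q ^ ((j : ℝ) + e - 1)
          + (if i = j then 1 else 0) * q ^ n * (q ^ e - q) := by
    intro i j
    have h1 : q ^ (j : ℕ) * q ^ (e - 1) = q ^ ((j : ℝ) + e - 1) := by
      rw [← Real.rpow_natCast, ← Real.rpow_add hq0, add_sub_assoc]
    have h2 : q * q ^ (e - 1) = q ^ e := by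
      nth_rewrite 1 [← Real.rpow_one q]
      rw [← Real.rpow_add hq0]
      congr 1
      ring
    simp only [quotientEntry, h1, h2, Subtype.ext_iff]
  rw [PolarForm.isQuotientMatrix_iff hn0 hr hX]
  constructor
  · intro h i j
    obtain ⟨hi, hi'⟩ := Finset.mem_Icc.1 i.2
    -- Every row is determined because every i is the type of some flag.
    obtain ⟨c, hc⟩ := PolarForm.MaxFlag.exists_type_eq hn0 hr hX hi hi'
    have hi : i = ⟨c.type X, c.type_mem_Icc hn0 X⟩ := Subtype.ext hc.symm
    rw [← hentry, hi, ← h c j, hcount, mul_div_cancel_left₀ _ hs.ne']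
  · intro h c j
    have := h ⟨c.type X, c.type_mem_Icc hn0 X⟩ j
    rw [← hentry, div_eq_iff hs.ne'] at this
    rw [this, hcount, mul_comm]
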